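/- A variety over a scheme $B$ is a reduced scheme of finite type over $B$. For a morphism of schemes $X\to B$, an $\mathbb A^1$-cylinder in $X$ over $B$ is a nonempty $B$-variety $Z$ together with an open immersion of $B$-schemes $Z\times\mathbb A^1\hookrightarrow X$. Let $k$ be an uncountable field of characteristic zero and let $f\colon X\to S$ be a dominant $k$-morphism between geometrically integral $k$-varieties. Suppose that for general closed points $s\in S$ (that is, for all closed points of some dense open subset of $S$) the fiber $X_s=X\times_S\operatorname{Spec}\kappa(s)$ contains an $\mathbb A^1$-cylinder $Z_s\times\mathbb A^1$ over a $\kappa(s)$-variety $Z_s$. Then there exists an étale morphism of $k$-varieties $T\to S$ such that $X_T=X\times_S T$ contains an $\mathbb A^1$-cylinder $Z\times\mathbb A^1$ over a $T$-variety $Z$. Equivalently, there also exists a finite extension $L'$ of the function field $L=\kappa(\eta)$ of $S$, where $\eta$ is the generic point of $S$, such that $X_\eta\times_{\operatorname{Spec}L}\operatorname{Spec}L'$ contains an $\mathbb A^1$-cylinder over an $L'$-variety, where $X_\eta$ is the fiber of $f$ over $\eta$. -/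

import Mathlib

open AlgebraicGeometry CategoryTheory CategoryTheory.Limits

universe u

/-- `p : X ⟶ B` makes `X` a variety over `B`: a reduced scheme of finite type over `B`. -/
structure IsVarietyOver {X B : Scheme.{u}} (p : X ⟶ B) : Prop where
  isReduced : IsReduced X
  locallyOfFiniteType : LocallyOfFiniteType p
  quasiCompact : QuasiCompact p

/-- An `𝔸¹`-cylinder in `X` over `B`, where `f : X ⟶ B`: a nonempty `B`-variety `Z` together
with an open immersion of `B`-schemes from `Z × 𝔸¹` (the affine line over `Z`) into `X`. -/
structure A1Cylinder {X B : Scheme.{u}} (f : X ⟶ B) where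
  /-- the base of the cylinder -/
  Z : Scheme.{u}
  /-- the structure morphism of the base -/
  p : Z ⟶ B
  /-- the embedding of the cylinder -/
  φ : 𝔸(PUnit.{u + 1}; Z) ⟶ X
  nonempty : Nonempty Z
  isVarietyOver : IsVarietyOver p
  isOpenImmersion : IsOpenImmersion φ
  w : φ ≫ f = (𝔸(PUnit.{u + 1}; Z) ↘ Z) ≫ p

/-- `X` is `𝔸¹`-cylindrical over `B`, where `f : X ⟶ B`. -/
def IsA1Cylindrical {X B : Scheme.{u}} (f : X ⟶ B) : Prop :=
  Nonempty (A1Cylinder f)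

/-! One sufficiently general closed fiber already controls the generic fiber. After shrinking, `S`
is `Spec A` with `A` a domain of finite type over `k`, and let `L` be its fraction field. Since `X`
is given by finitely many data over `A`, it comes from a scheme of finite type over a countable
noetherian subring `R` of `A` (`exists_countable_model`).

Because `k` is uncountable, some maximal ideal `m` of `A` satisfies `m ∩ R = 0`
(`exists_isMaximal_comap_eq_bot`): a residue field of the localization of `A` at the nonzero
elements of `R` is countably generated as a `k`-algebra, hence algebraic over `k`, so its maximal
ideal contracts to a maximal ideal of `A`. The fiber of `X` over `m` is then a base change of the
`R`-model along an injection of `R` into a field.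

The cylinder in that fiber is again given by finitely many data, so it lives over a ring of finite
type over `R`. With `Spec C` the descended base of the cylinder, a compatible point of `C` in an
extension `B` of `A` with suitable flatness and unramifiedness yields a cylinder in `X_B`
(`Model.exists_ring_of_isA1Cylindrical`). As `R` injects into a residue field of `C`, the generic
fiber of `A ⊗[R] C` over `A` is nonzero. The Nullstellensatz gives it a point in a finite extension
`L'` of `L`, and the image of `A ⊗[R] C` in `L'` is generically étale over `A` in characteristic
zero (`exists_finite_and_exists_etale`). These two points give the two conclusions.

All descent is along the filtered union of finitely generated subalgebras: opens, morphisms and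
isomorphisms descend by limit arguments, affine schemes through presentations, and general schemes
by gluing. -/

/-! ### Algebras as filtered unions of finitely generated subalgebras -/

section FGSubalgebra

variable (R A : Type u) [CommRing R] [CommRing A] [Algebra R A]

/-- The poset of finitely generated subalgebras. -/
abbrev FGSubalgebra : Type u := {C : Subalgebra R A // C.FG}

namespace FGSubalgebra

instance : Nonempty (FGSubalgebra R A) := ⟨⟨⊥, Subalgebra.fg_bot⟩⟩

instance : IsDirectedOrder (FGSubalgebra R A) :=
  ⟨fun C D ↦ ⟨⟨C.1 ⊔ D.1, C.2.sup D.2⟩, le_sup_left (a := C.1), le_sup_right (a := C.1)⟩⟩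

/-- The diagram of finitely generated subalgebras. -/
@[simps] def diagram : FGSubalgebra R A ⥤ CommRingCat.{u} where
  obj C := .of C.1
  map h := CommRingCat.ofHom (Subalgebra.inclusion h.le).toRingHom

/-- An algebra as a cocone under its finitely generated subalgebras. -/
@[simps] def cocone : Cocone (diagram R A) where
  pt := .of A
  ι := { app C := CommRingCat.ofHom C.1.val.toRingHom }

lemma exists_mem (x : A) : ∃ C : FGSubalgebra R A, x ∈ C.1 :=
  ⟨⟨Algebra.adjoin R {x}, ⟨{x}, by simp⟩⟩, Algebra.subset_adjoin rfl⟩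

/-- An algebra is the colimit of its finitely generated subalgebras. -/
noncomputable def isColimitCocone : IsColimit (cocone R A) :=
  haveI : ReflectsColimit (diagram R A) (forget CommRingCat) :=
    reflectsColimit_of_reflectsIsomorphisms _ _
  isColimitOfReflects (forget CommRingCat) <|
    Types.FilteredColimit.isColimitOf _ _
      (fun x ↦ by
        obtain ⟨C, hC⟩ := exists_mem R A x
        exact ⟨C, ⟨x, hC⟩, rfl⟩)
      (fun C D x y h ↦ by
        obtain ⟨E, hC, hD⟩ := exists_ge_ge C D
        exact ⟨E, homOfLE hC, homOfLE hD, Subtype.ext h⟩)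

/-- The spectra of the finitely generated subalgebras. -/
noncomputable abbrev specDiagram : (FGSubalgebra R A)ᵒᵖ ⥤ Scheme.{u} :=
  (diagram R A).op ⋙ Scheme.Spec

/-- The spectrum of an algebra as a cone over those of its finitely generated subalgebras. -/
noncomputable abbrev specCone : Cone (specDiagram R A) := Scheme.Spec.mapCone (cocone R A).op

/-- The spectrum of an algebra is the limit of those of its finitely generated subalgebras. -/
noncomputable def isLimitSpecCone : IsLimit (specCone R A) :=
  isLimitOfPreserves _ (isColimitCocone R A).op

/-- The structure morphisms of the diagram of spectra. -/
noncomputable def specBase (C : (FGSubalgebra R A)ᵒᵖ) :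
    (specDiagram R A).obj C ⟶ Spec (.of R) :=
  Spec.map (CommRingCat.ofHom (algebraMap R C.unop.1))

lemma specBase_naturality {C D : (FGSubalgebra R A)ᵒᵖ} (h : C ⟶ D) :
    (specDiagram R A).map h ≫ specBase R A D = specBase R A C :=
  (Spec.map_comp _ _).symm

instance : CategoryTheory.IsConnected (FGSubalgebra R A)ᵒᵖ := IsCofiltered.isConnected _

end FGSubalgebra
end FGSubalgebra

/-! ### Base change of connected limits -/

section PullbackDiagram

lemma lift_comp_lift_snd {C : Type*} [Category* C] [HasPullbacks C] {S X T T' W : C} (x : X ⟶ S)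
    {t : T ⟶ S} {t' : T' ⟶ S} (d : T ⟶ T') (i : W ⟶ X) (g : W ⟶ T) (h : i ≫ x = g ≫ t)
    (hd : d ≫ t' = t) :
    pullback.lift i g h ≫ pullback.lift (pullback.fst x t) (pullback.snd x t ≫ d)
      (by rw [pullback.condition, Category.assoc, hd]) =
    pullback.lift i (g ≫ d) (by rw [h, Category.assoc, hd]) :=
  pullback.hom_ext (by simp [pullback.lift_fst]) (by simp [pullback.lift_snd,
    pullback.lift_snd_assoc])

variable {J : Type*} [Category* J] {C : Type*} [Category* C] [HasPullbacks C] (D : J ⥤ C) {S X : C}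
  (t : ∀ j, D.obj j ⟶ S) (ht : ∀ {j k : J} (h : j ⟶ k), D.map h ≫ t k = t j) (x : X ⟶ S)

/-- The base change of a diagram of objects over `S` along `x : X ⟶ S`. -/
@[simps] noncomputable def pullbackDiagram : J ⥤ C where
  obj j := pullback x (t j)
  map {j k} h := pullback.lift (pullback.fst _ _) (pullback.snd _ _ ≫ D.map h) (by
    rw [pullback.condition, Category.assoc, ht])
  map_id j := by apply pullback.hom_ext <;> simp
  map_comp _ _ := pullback.hom_ext (by simp only [Category.assoc, pullback.lift_fst])
    (by simp only [Category.assoc, pullback.lift_snd, pullback.lift_snd_assoc, D.map_comp])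

/-- A cone over the base change of a diagram. -/
@[simps] noncomputable def pullbackCone (c : Cone D) {Y : C} (i : Y ⟶ X) (f : Y ⟶ c.pt)
    (h : ∀ j, i ≫ x = (f ≫ c.π.app j) ≫ t j) : Cone (pullbackDiagram D t ht x) where
  pt := Y
  π :=
  { app j := pullback.lift i (f ≫ c.π.app j) (h j)
    naturality j k g := by
      refine (Category.id_comp _).trans (Eq.trans ?_ (lift_comp_lift_snd x (D.map g) i
        (f ≫ c.π.app j)
        (h j) (ht g)).symm)
      congr 1
      rw [Category.assoc, c.w] }

/-- Base change commutes with connected limits. -/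
noncomputable def isLimitPullbackCone [CategoryTheory.IsConnected J] (c : Cone D) {Y : C}
    (i : Y ⟶ X) (f : Y ⟶ c.pt) (h : ∀ j, i ≫ x = (f ≫ c.π.app j) ≫ t j) (hc : IsLimit c)
    (H : ∀ j, IsPullback (pullback.lift i (f ≫ c.π.app j) (h j)) f (pullback.snd x (t j))
      (c.π.app j)) :
    IsLimit (pullbackCone D t ht x c i f h) :=
  isLimitOfIsPullbackOfIsConnected (F := pullbackDiagram D t ht x) (G := D)
    { app j := pullback.snd x (t j)
      naturality _ _ _ := pullback.lift_snd _ _ _ } _ c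
    { hom := f, w _ := (pullback.lift_snd _ _ _).symm } H hc

end PullbackDiagram

/-! ### Models over rings of finite type; descent of opens and morphisms -/

/-- A factorization of a ring map through a ring of finite type over the source. -/
structure FiniteFactorization {R A : CommRingCat.{u}} (a : R ⟶ A) where
  /-- the intermediate ring -/
  ring : CommRingCat.{u}
  /-- the finite type map -/
  q : R ⟶ ring
  /-- the map to the target -/
  p : ring ⟶ A
  fac : q ≫ p = a
  finiteType : q.hom.FiniteType

namespace FiniteFactorization

variable {R A : CommRingCat.{u}} {a : R ⟶ A}

/-- Composition of finite factorizations. -/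
abbrev trans (s : FiniteFactorization a) (t : FiniteFactorization s.p) :
    FiniteFactorization a where
  ring := t.ring
  q := s.q ≫ t.q
  p := t.p
  fac := by rw [Category.assoc, t.fac, s.fac]
  finiteType := t.finiteType.comp s.finiteType

lemma isNoetherianRing [IsNoetherianRing R] (s : FiniteFactorization a) :
    IsNoetherianRing s.ring := by
  let := s.q.hom.toAlgebra
  have : Algebra.FiniteType R s.ring := s.finiteType
  exact Algebra.FiniteType.isNoetherianRing R s.ring

/-- The factorization through a finitely generated subalgebra. -/
@[simps] def ofSubalgebra (a : R ⟶ A) (C : letI := a.hom.toAlgebra; FGSubalgebra R A) :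
    FiniteFactorization a :=
  letI := a.hom.toAlgebra
  { ring := .of C.1
    q := CommRingCat.ofHom (algebraMap R C.1)
    p := CommRingCat.ofHom C.1.val.toRingHom
    fac := rfl
    finiteType := by
      have : Algebra.FiniteType R C.1 := (Subalgebra.fg_iff_finiteType _).mp C.2
      exact RingHom.finiteType_algebraMap.mpr this }

end FiniteFactorization

/-- A descent of `f : Y ⟶ Spec A` along `a : R ⟶ A` to a scheme of finite type over `R`. -/
structure Model {A : CommRingCat.{u}} {Y : Scheme.{u}} (f : Y ⟶ Spec A) {R : CommRingCat.{u}}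
    (a : R ⟶ A) where
  /-- the descended scheme -/
  X : Scheme.{u}
  /-- its structure morphism -/
  x : X ⟶ Spec R
  /-- the projection -/
  i : Y ⟶ X
  isPullback : IsPullback i f x (Spec.map a)
  locallyOfFiniteType : LocallyOfFiniteType x
  quasiCompact : QuasiCompact x

namespace Model

attribute [instance] locallyOfFiniteType quasiCompact

variable {A : CommRingCat.{u}} {Y : Scheme.{u}} {f : Y ⟶ Spec A} {R : CommRingCat.{u}} {a : R ⟶ A}

/-- Base change of a model along a factorization. -/
@[simps X x i] noncomputable def baseChange (M : Model f a) {R' : CommRingCat.{u}} (q : R ⟶ R')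
    (p : R' ⟶ A) (h : q ≫ p = a) : Model f p where
  X := pullback M.x (Spec.map q)
  x := pullback.snd _ _
  i := pullback.lift M.i (f ≫ Spec.map p) (by
    rw [M.isPullback.w, Category.assoc, ← Spec.map_comp, h])
  isPullback := by
    refine IsPullback.of_right (t := IsPullback.of_hasPullback M.x (Spec.map q)) ?_
      (pullback.lift_snd _ _ _)
    rw [pullback.lift_fst, ← Spec.map_comp, h]
    exact M.isPullback
  locallyOfFiniteType := inferInstance
  quasiCompact := inferInstance

/-- The projection from a base change of a model. -/
noncomputable def fst (M : Model f a) {R' : CommRingCat.{u}} (q : R ⟶ R')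
    (p : R' ⟶ A) (h : q ≫ p = a) : (M.baseChange q p h).X ⟶ M.X := pullback.fst _ _

@[simp]
lemma i_fst (M : Model f a) {R' : CommRingCat.{u}} (q : R ⟶ R')
    (p : R' ⟶ A) (h : q ≫ p = a) : (M.baseChange q p h).i ≫ M.fst q p h = M.i :=
  pullback.lift_fst _ _ _

@[simp]
lemma i_fst_assoc (M : Model f a) {R' : CommRingCat.{u}} (q : R ⟶ R')
    (p : R' ⟶ A) (h : q ≫ p = a) {W : Scheme.{u}} (m : M.X ⟶ W) :
    (M.baseChange q p h).i ≫ M.fst q p h ≫ m = M.i ≫ m := by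
  rw [← Category.assoc, i_fst]

lemma isPullback_fst (M : Model f a) {R' : CommRingCat.{u}} (q : R ⟶ R')
    (p : R' ⟶ A) (h : q ≫ p = a) :
    IsPullback (M.fst q p h) (M.baseChange q p h).x M.x (Spec.map q) :=
  IsPullback.of_hasPullback _ _

/-- Base change of a model along a finite factorization. -/
noncomputable abbrev at' (M : Model f a) (s : FiniteFactorization a) : Model f s.p :=
  M.baseChange s.q s.p s.fac

/-- The projection from a base change of a model. -/
noncomputable abbrev proj (M : Model f a) (s : FiniteFactorization a) : (M.at' s).X ⟶ M.X :=
  M.fst s.q s.p s.fac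

lemma isNoetherian [IsNoetherianRing R] (M : Model f a) : IsNoetherian M.X where
  toIsLocallyNoetherian := LocallyOfFiniteType.isLocallyNoetherian M.x
  toCompactSpace := QuasiCompact.compactSpace_of_compactSpace M.x

section Limit

variable (M : Model f a)

open FiniteFactorization Opposite

/-- The base changes of a model to finitely generated subalgebras. -/
noncomputable abbrev diagram :
    letI := a.hom.toAlgebra; (FGSubalgebra R A)ᵒᵖ ⥤ Scheme.{u} :=
  letI := a.hom.toAlgebra
  pullbackDiagram _ (FGSubalgebra.specBase R A) (FGSubalgebra.specBase_naturality R A) M.x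

/-- The total space as a cone over the diagram of models. -/
noncomputable abbrev cone : Cone M.diagram :=
  letI := a.hom.toAlgebra
  pullbackCone _ _ (FGSubalgebra.specBase_naturality R A) M.x (FGSubalgebra.specCone R A) M.i f
    (fun _ ↦ by
    refine M.isPullback.w.trans (congr(f ≫ $(?_)).trans (Category.assoc _ _ _).symm)
    exact Spec.map_comp (ofSubalgebra a _).q (ofSubalgebra a _).p)

/-- The total space is the limit of its models over the finitely generated subalgebras. -/
noncomputable def isLimitCone : IsLimit M.cone :=
  letI := a.hom.toAlgebra
  isLimitPullbackCone _ _ (FGSubalgebra.specBase_naturality R A) M.x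
    (FGSubalgebra.specCone R A) M.i f _
    (FGSubalgebra.isLimitSpecCone R A) (fun C ↦ (M.at' (ofSubalgebra a C.unop)).isPullback)

end Limit

end Model

/-- Composing with the affine projection to `X` gives another affine projection, so affineness
cancels. This makes the transition maps between models affine, as the limit arguments require. -/
lemma isAffineHom_pullbackLift {X S T T' : Scheme.{u}} (x : X ⟶ S) (t : T ⟶ S) (t' : T' ⟶ S)
    (d : T ⟶ T') (h : pullback.fst x t ≫ x = (pullback.snd x t ≫ d) ≫ t') [IsAffineHom t]
    [IsAffineHom t'] :
    IsAffineHom (pullback.lift (pullback.fst x t) (pullback.snd x t ≫ d) h) := by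
  have : IsAffineHom (pullback.lift (pullback.fst x t) (pullback.snd x t ≫ d) h ≫
      pullback.fst x t') := by
    rw [pullback.lift_fst]
    exact MorphismProperty.of_isPullback (IsPullback.of_hasPullback x t).flip ‹_›
  have : IsAffineHom (pullback.fst x t') :=
    MorphismProperty.of_isPullback (IsPullback.of_hasPullback x t').flip ‹_›
  exact .of_comp _ (pullback.fst x t')

namespace Model

variable {A : CommRingCat.{u}} {Y Y' : Scheme.{u}} {f : Y ⟶ Spec A} {g : Y' ⟶ Spec A}
  {R : CommRingCat.{u}} {a : R ⟶ A}

instance (M : Model f a) (s : FiniteFactorization a) : IsAffineHom (M.proj s) :=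
  MorphismProperty.of_isPullback (M.isPullback_fst _ _ _).flip inferInstance

instance (M : Model f a) {C D} (h : C ⟶ D) : IsAffineHom (M.diagram.map h) :=
  have : IsAffineHom (Spec.map (FiniteFactorization.ofSubalgebra a C.unop).q) := inferInstance
  have : IsAffineHom (Spec.map (FiniteFactorization.ofSubalgebra a D.unop).q) := inferInstance
  isAffineHom_pullbackLift M.x (Spec.map (FiniteFactorization.ofSubalgebra a C.unop).q)
    (Spec.map (FiniteFactorization.ofSubalgebra a D.unop).q) _ _

/-- Opens over a filtered colimit of rings descend to a finite level. -/
theorem exists_opens (M : Model f a) (U : Y.Opens) (hU : IsCompact (U : Set Y)) :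
    ∃ (s : FiniteFactorization a) (V : (M.at' s).X.Opens), (M.at' s).i ⁻¹ᵁ V = U := by
  obtain ⟨C, V, -, h⟩ := exists_preimage_eq M.diagram M.cone M.isLimitCone U hU
  exact ⟨.ofSubalgebra a C.unop, V, h⟩

section

variable [IsNoetherianRing R]

lemma isNoetherian_at' (M : Model f a) (s : FiniteFactorization a) : IsNoetherian (M.at' s).X :=
  have := s.isNoetherianRing
  (M.at' s).isNoetherian

instance (M : Model f a) (C) : CompactSpace (M.diagram.obj C) :=
  have := M.isNoetherian_at' (.ofSubalgebra a C.unop)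
  inferInstanceAs (CompactSpace (M.at' (.ofSubalgebra a C.unop)).X)

instance (M : Model f a) (C) : QuasiSeparatedSpace (M.diagram.obj C) :=
  have := M.isNoetherian_at' (.ofSubalgebra a C.unop)
  inferInstanceAs (QuasiSeparatedSpace (M.at' (.ofSubalgebra a C.unop)).X)

/-- The structure morphisms of the diagram of models. -/
noncomputable def diagramBase (M : Model f a) :
    M.diagram ⟶ (Functor.const _).obj (Spec R) where
  app C := M.proj (.ofSubalgebra a C.unop) ≫ M.x
  naturality C D h := by
    have h1 : M.diagram.map h ≫ M.proj (.ofSubalgebra a D.unop) =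
      M.proj (.ofSubalgebra a C.unop) := pullback.lift_fst _ _ _
    refine (Category.assoc _ _ _).symm.trans ((congr($h1 ≫ M.x)).trans (Category.comp_id _).symm)

/-- Morphisms over a filtered colimit of rings descend to a finite level. -/
theorem exists_hom (M : Model f a) (N : Model g a) (m : Y ⟶ Y') (hm : m ≫ g = f) :
    ∃ (s : FiniteFactorization a) (m' : (M.at' s).X ⟶ (N.at' s).X),
      m' ≫ (N.at' s).x = (M.at' s).x ∧ (M.at' s).i ≫ m' = m ≫ (N.at' s).i := by
  -- Over the noetherian ring `R`, finite type is finite presentation, which is what descent of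
  -- morphisms needs.
  have : LocallyOfFinitePresentation N.x :=
    LocallyOfFinitePresentation.iff_locallyOfFiniteType.mpr inferInstance
  obtain ⟨C, m', h1, h2⟩ := Scheme.exists_π_app_comp_eq_of_locallyOfFinitePresentation M.diagram
    M.diagramBase N.x M.cone M.isLimitCone (m ≫ N.i) (by
      ext1; ext1 C
      change (M.at' (.ofSubalgebra a C.unop)).i ≫ M.proj (.ofSubalgebra a C.unop) ≫ M.x =
        (m ≫ N.i) ≫ N.x
      rw [i_fst_assoc, M.isPullback.w, Category.assoc, N.isPullback.w, ← hm, Category.assoc])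
  let s := FiniteFactorization.ofSubalgebra a C.unop
  change (M.at' s).X ⟶ N.X at m'
  change (M.at' s).i ≫ m' = _ at h1
  change m' ≫ N.x = M.proj s ≫ M.x at h2
  have h3 : m' ≫ N.x = (M.at' s).x ≫ Spec.map s.q := h2.trans (M.isPullback_fst _ _ _).w
  refine ⟨s, (N.isPullback_fst _ _ _).lift m' (M.at' s).x h3, ?_, ?_⟩
  · exact IsPullback.lift_snd _ _ _ _
  · apply (N.isPullback_fst _ _ _).hom_ext
    · rw [Category.assoc, IsPullback.lift_fst, h1, Category.assoc]
      exact congr(m ≫ $((N.i_fst _ _ _).symm))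
    · rw [Category.assoc, IsPullback.lift_snd, Category.assoc]
      refine (M.at' s).isPullback.w.trans ?_
      refine Eq.trans ?_ congr(m ≫ $((N.at' s).isPullback.w.symm))
      rw [← hm, Category.assoc]

/-- Equality of morphisms over a filtered colimit of rings descends to a finite level. -/
theorem exists_proj_comp_eq (M : Model f a) {X : Scheme.{u}} (x : X ⟶ Spec R)
    [LocallyOfFiniteType x] (m n : M.X ⟶ X) (hm : m ≫ x = M.x) (hn : n ≫ x = M.x)
    (h : M.i ≫ m = M.i ≫ n) :
    ∃ s : FiniteFactorization a, M.proj s ≫ m = M.proj s ≫ n := by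
  let := a.hom.toAlgebra
  -- `M.X` need not be a stage of the diagram, since `a` may fail to be injective and the smallest
  -- stage is the image of `R`. Both maps are therefore first pulled back to that stage.
  let C₀ : (FGSubalgebra R A)ᵒᵖ := .op ⟨⊥, Subalgebra.fg_bot⟩
  let m₀ : M.diagram.obj C₀ ⟶ X := M.proj (.ofSubalgebra a C₀.unop) ≫ m
  let n₀ : M.diagram.obj C₀ ⟶ X := M.proj (.ofSubalgebra a C₀.unop) ≫ n
  have hm₀ : M.diagramBase.app C₀ = m₀ ≫ x :=
    congr(M.proj (.ofSubalgebra a C₀.unop) ≫ $hm.symm).trans (Category.assoc _ _ _).symm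
  have hn₀ : M.diagramBase.app C₀ = n₀ ≫ x :=
    congr(M.proj (.ofSubalgebra a C₀.unop) ≫ $hn.symm).trans (Category.assoc _ _ _).symm
  have h₀ : M.cone.π.app C₀ ≫ m₀ = M.cone.π.app C₀ ≫ n₀ :=
    (M.i_fst_assoc _ _ _ m).trans (h.trans (M.i_fst_assoc _ _ _ n).symm)
  obtain ⟨C, k, h1⟩ := Scheme.exists_hom_comp_eq_comp_of_locallyOfFiniteType M.diagram
    M.diagramBase x M.cone M.isLimitCone m₀ n₀ hm₀ hn₀ h₀
  have h2 : M.diagram.map k ≫ M.proj (.ofSubalgebra a C₀.unop) =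
    M.proj (.ofSubalgebra a C.unop) := pullback.lift_fst _ _ _
  refine ⟨.ofSubalgebra a C.unop, ?_⟩
  rw [← h2]
  exact (Category.assoc _ _ _).trans (h1.trans (Category.assoc _ _ _).symm)

end

end Model

/-! ### Descent of isomorphisms -/

namespace Model

variable {A : CommRingCat.{u}} {Y Y' : Scheme.{u}} {f : Y ⟶ Spec A} {g : Y' ⟶ Spec A}
  {R : CommRingCat.{u}} {a : R ⟶ A}

/-- Two morphisms into the base change of a model agree if their projections do. -/
lemma hom_ext_at' (M : Model f a) (s : FiniteFactorization a) {W : Scheme.{u}}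
    {m n : W ⟶ (M.at' s).X} (h : m ≫ M.proj s = n ≫ M.proj s)
    (h' : m ≫ (M.at' s).x = n ≫ (M.at' s).x) : m = n :=
  (M.isPullback_fst _ _ _).hom_ext h h'

/-- Base change of a morphism of models. -/
noncomputable def map (M : Model f a) (N : Model g a) (m : M.X ⟶ N.X) (hm : m ≫ N.x = M.x)
    (s : FiniteFactorization a) : (M.at' s).X ⟶ (N.at' s).X :=
  (N.isPullback_fst _ _ _).lift (M.proj s ≫ m) (M.at' s).x (by
    rw [Category.assoc, hm]
    exact (M.isPullback_fst _ _ _).w)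

section

variable (M : Model f a) (N : Model g a) (m : M.X ⟶ N.X) (hm : m ≫ N.x = M.x)
    (s : FiniteFactorization a)

lemma map_proj : M.map N m hm s ≫ N.proj s = M.proj s ≫ m := IsPullback.lift_fst _ _ _ _

lemma map_x : M.map N m hm s ≫ (N.at' s).x = (M.at' s).x := IsPullback.lift_snd _ _ _ _

lemma i_map {e : Y ⟶ Y'} (he : e ≫ g = f) (h : M.i ≫ m = e ≫ N.i) :
    (M.at' s).i ≫ M.map N m hm s = e ≫ (N.at' s).i := by
  apply N.hom_ext_at'
  · rw [Category.assoc, map_proj, i_fst_assoc, h, Category.assoc, i_fst]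
  · rw [Category.assoc, map_x, Category.assoc]
    refine (M.at' s).isPullback.w.trans (Eq.trans ?_ congr(e ≫ $((N.at' s).isPullback.w.symm)))
    rw [← he, Category.assoc]

lemma map_comp_map_eq_id {n : N.X ⟶ M.X} (hn : n ≫ M.x = N.x) (h : M.proj s ≫ m ≫ n = M.proj s) :
    M.map N m hm s ≫ N.map M n hn s = 𝟙 _ := by
  apply M.hom_ext_at'
  · rw [Category.assoc, map_proj, ← Category.assoc, map_proj, Category.assoc, h, Category.id_comp]
  · rw [Category.assoc, map_x, map_x, Category.id_comp]

end

/-- Iterated base change of models. -/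
noncomputable def transIso (M : Model f a) (s : FiniteFactorization a)
    (t : FiniteFactorization s.p) : ((M.at' s).at' t).X ≅ (M.at' (s.trans t)).X :=
  IsPullback.isoIsPullback _ _ (((M.at' s).isPullback_fst t.q t.p t.fac).paste_horiz
    (M.isPullback_fst s.q s.p s.fac))
    (by rw [← Spec.map_comp]; exact M.isPullback_fst (s.q ≫ t.q) t.p (s.trans t).fac)

section

variable (M : Model f a) (s : FiniteFactorization a) (t : FiniteFactorization s.p)

lemma transIso_hom_proj : (M.transIso s t).hom ≫ M.proj (s.trans t) =
    (M.at' s).proj t ≫ M.proj s := IsPullback.isoIsPullback_hom_fst _ _ _ _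

lemma transIso_hom_x : (M.transIso s t).hom ≫ (M.at' (s.trans t)).x =
    ((M.at' s).at' t).x := IsPullback.isoIsPullback_hom_snd _ _ _ _

lemma transIso_inv_x : (M.transIso s t).inv ≫ ((M.at' s).at' t).x =
    (M.at' (s.trans t)).x := by rw [Iso.inv_comp_eq, transIso_hom_x]

lemma i_transIso_hom : ((M.at' s).at' t).i ≫ (M.transIso s t).hom = (M.at' (s.trans t)).i := by
  apply M.hom_ext_at'
  · rw [Category.assoc, transIso_hom_proj, i_fst_assoc, i_fst]
    exact (M.i_fst _ _ _).symm
  · rw [Category.assoc, transIso_hom_x]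
    exact ((M.at' s).at' t).isPullback.w.trans (M.at' (s.trans t)).isPullback.w.symm

lemma i_transIso_inv : (M.at' (s.trans t)).i ≫ (M.transIso s t).inv = ((M.at' s).at' t).i := by
  rw [Iso.comp_inv_eq, i_transIso_hom]

end

/-- An isomorphism between the total spaces of two models descends to a finite level. -/
def DescendsIso (M : Model f a) (N : Model g a) (e : Y ≅ Y') : Prop :=
  ∃ (s : FiniteFactorization a) (e' : (M.at' s).X ≅ (N.at' s).X),
    e'.hom ≫ (N.at' s).x = (M.at' s).x ∧ (M.at' s).i ≫ e'.hom = e.hom ≫ (N.at' s).i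

lemma DescendsIso.of_iso {M : Model f a} {N : Model g a} {e : Y ≅ Y'} {s : FiniteFactorization a}
    (e' : (M.at' s).X ≅ (N.at' s).X) (h : e'.hom ≫ (N.at' s).x = (M.at' s).x)
    (h' : (M.at' s).i ≫ e'.hom = e.hom ≫ (N.at' s).i) : DescendsIso M N e :=
  ⟨s, e', h, h'⟩

/-- Lets descent proceed in successive enlargements of the ring: an iterated base change is the base
change along the composite factorization. -/
lemma DescendsIso.of_at' {M : Model f a} {N : Model g a} {e : Y ≅ Y'} {s : FiniteFactorization a}
    (h : DescendsIso (M.at' s) (N.at' s) e) : DescendsIso M N e := by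
  obtain ⟨t, e', h1, h2⟩ := h
  refine ⟨s.trans t, (M.transIso s t).symm ≪≫ e' ≪≫ N.transIso s t, ?_, ?_⟩
  · simp only [Iso.trans_hom, Iso.symm_hom, Category.assoc]
    rw [transIso_hom_x, h1, transIso_inv_x]
  · simp only [Iso.trans_hom, Iso.symm_hom]
    rw [← Category.assoc, i_transIso_inv, ← Category.assoc, h2, Category.assoc, i_transIso_hom]

/-- Isomorphisms over a filtered colimit of rings descend to a finite level. -/
theorem exists_iso [IsNoetherianRing R] (M : Model f a) (N : Model g a) (e : Y ≅ Y')
    (he : e.hom ≫ g = f) : DescendsIso M N e := by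
  have he' : e.inv ≫ f = g := by rw [Iso.inv_comp_eq, he]
  obtain ⟨s₁, m₁, hm₁, im₁⟩ := M.exists_hom N e.hom he
  have := s₁.isNoetherianRing
  obtain ⟨s₂, n₂, hn₂, in₂⟩ := (N.at' s₁).exists_hom (M.at' s₁) e.inv he'
  have := s₂.isNoetherianRing
  let M₂ := (M.at' s₁).at' s₂
  let N₂ := (N.at' s₁).at' s₂
  let m₂ : M₂.X ⟶ N₂.X := (M.at' s₁).map (N.at' s₁) m₁ hm₁ s₂
  have hm₂ : m₂ ≫ N₂.x = M₂.x := map_x ..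
  have im₂ : M₂.i ≫ m₂ = e.hom ≫ N₂.i := i_map _ _ _ _ _ he im₁
  -- The descended maps become mutually inverse only in the limit; `s₃` enforces one composite
  -- identity and `s₄` the other.
  obtain ⟨s₃, h₃⟩ := M₂.exists_proj_comp_eq M₂.x (m₂ ≫ n₂) (𝟙 _)
    (by rw [Category.assoc, hn₂, hm₂]) (Category.id_comp _)
    (by rw [reassoc_of% im₂, in₂, e.hom_inv_id_assoc, Category.comp_id])
  rw [Category.comp_id] at h₃
  have := s₃.isNoetherianRing
  let M₃ := M₂.at' s₃
  let N₃ := N₂.at' s₃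
  let m₃ : M₃.X ⟶ N₃.X := M₂.map N₂ m₂ hm₂ s₃
  let n₃ : N₃.X ⟶ M₃.X := N₂.map M₂ n₂ hn₂ s₃
  have hm₃ : m₃ ≫ N₃.x = M₃.x := map_x ..
  have hn₃ : n₃ ≫ M₃.x = N₃.x := map_x ..
  have im₃ : M₃.i ≫ m₃ = e.hom ≫ N₃.i := i_map _ _ _ _ _ he im₂
  have in₃ : N₃.i ≫ n₃ = e.inv ≫ M₃.i := i_map _ _ _ _ _ he' in₂
  have hmn : m₃ ≫ n₃ = 𝟙 _ := map_comp_map_eq_id _ _ _ _ _ _ h₃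
  obtain ⟨s₄, h₄⟩ := N₃.exists_proj_comp_eq N₃.x (n₃ ≫ m₃) (𝟙 _)
    (by rw [Category.assoc, hm₃, hn₃]) (Category.id_comp _)
    (by rw [reassoc_of% in₃, im₃, e.inv_hom_id_assoc, Category.comp_id])
  rw [Category.comp_id] at h₄
  let e₄ : (M₃.at' s₄).X ≅ (N₃.at' s₄).X :=
    ⟨M₃.map N₃ m₃ hm₃ s₄, N₃.map M₃ n₃ hn₃ s₄,
      map_comp_map_eq_id _ _ _ _ _ _ (by rw [hmn, Category.comp_id]),
      map_comp_map_eq_id _ _ _ hn₃ _ hm₃ h₄⟩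
  have he₄ : e₄.hom ≫ (N₃.at' s₄).x = (M₃.at' s₄).x := map_x _ _ _ hm₃ _
  have ie₄ : (M₃.at' s₄).i ≫ e₄.hom = e.hom ≫ (N₃.at' s₄).i := i_map _ _ _ hm₃ _ he im₃
  exact (((DescendsIso.of_iso e₄ he₄ ie₄).of_at').of_at').of_at'

end Model

/-! ### Gluing two schemes along a common open subscheme -/

section Glue

/-- The open cover by two jointly surjective open immersions. -/
noncomputable def coverOfTwo {U V X : Scheme.{u}} (u : U ⟶ X) (v : V ⟶ X) [IsOpenImmersion u]
    [IsOpenImmersion v] (h : ∀ x : X, x ∈ Set.range u ∨ x ∈ Set.range v) :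
    Scheme.OpenCover.{0} X :=
  Scheme.Cover.mkOfCovers Bool (fun b ↦ cond b U V) (fun b ↦ match b with | true => u | false => v)
    (fun x ↦ (h x).elim (fun ⟨y, hy⟩ ↦ ⟨true, y, hy⟩) (fun ⟨y, hy⟩ ↦ ⟨false, y, hy⟩))
    (fun b ↦ match b with | true => ‹IsOpenImmersion u› | false => ‹IsOpenImmersion v›)

/-- Two open immersions with a common source have a pushout of the expected shape. -/
lemma exists_isPushout_of_isOpenImmersion {N P₁ P₂ : Scheme.{u}} (j₁ : N ⟶ P₁) (j₂ : N ⟶ P₂)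
    [IsOpenImmersion j₁] [IsOpenImmersion j₂] :
    ∃ (P : Scheme.{u}) (v₁ : P₁ ⟶ P) (v₂ : P₂ ⟶ P), IsOpenImmersion v₁ ∧ IsOpenImmersion v₂ ∧
      IsPushout j₁ j₂ v₁ v₂ ∧ (∀ x : P, x ∈ Set.range v₁ ∨ x ∈ Set.range v₂) ∧
      ∀ (x : P₁) (y : P₂), v₁ x = v₂ y → ∃ n : N, j₁ n = x ∧ j₂ n = y := by
  let F := span j₁ j₂
  have (i j : WalkingSpan) (f : i ⟶ j) : IsOpenImmersion (F.map f) := by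
    match i, j, f with
    | i, _, .id _ => exact (F.map_id i).symm ▸ inferInstance
    | _, _, .init .left => assumption
    | _, _, .init .right => assumption
  have : HasPushout j₁ j₂ := inferInstanceAs (HasColimit F)
  have h₁ : IsOpenImmersion (pushout.inl j₁ j₂) :=
    inferInstanceAs (IsOpenImmersion (colimit.ι F .left))
  have h₂ : IsOpenImmersion (pushout.inr j₁ j₂) :=
    inferInstanceAs (IsOpenImmersion (colimit.ι F .right))
  refine ⟨pushout j₁ j₂, pushout.inl _ _, pushout.inr _ _, h₁, h₂, .of_hasPushout _ _, ?_, ?_⟩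
  · intro x
    obtain ⟨i, y, hy⟩ := Scheme.IsLocallyDirected.ι_jointly_surjective F x
    match i with
    | none =>
      refine .inl ⟨j₁ y, ?_⟩
      refine Eq.trans ?_ hy
      exact congr($(colimit.w F (WidePushoutShape.Hom.init WalkingPair.left)) y)
    | some .left => exact .inl ⟨y, hy⟩
    | some .right => exact .inr ⟨y, hy⟩
  · intro x y hxy
    obtain ⟨k, f, g, z, hx, hy⟩ := (Scheme.IsLocallyDirected.ι_eq_ι_iff F
      (i := .left) (j := .right) (xi := x) (xj := y)).mp hxy
    match k, f, g with
    | none, .init _, .init _ => exact ⟨z, hx, hy⟩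

/-- Gluing morphisms along a cover by two open subschemes. -/
lemma exists_glue_of_isPullback {W U V X P : Scheme.{u}} {w₁ : W ⟶ U} {w₂ : W ⟶ V} {u : U ⟶ X}
    {v : V ⟶ X} [IsOpenImmersion u] [IsOpenImmersion v] (hW : IsPullback w₁ w₂ u v)
    (h : ∀ x : X, x ∈ Set.range u ∨ x ∈ Set.range v) (a : U ⟶ P) (b : V ⟶ P)
    (hab : w₁ ≫ a = w₂ ≫ b) : ∃ i : X ⟶ P, u ≫ i = a ∧ v ≫ i = b := by
  have hfs : pullback.fst u v ≫ a = pullback.snd u v ≫ b := by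
    rw [← cancel_epi hW.isoPullback.hom, IsPullback.isoPullback_hom_fst_assoc, hab,
      IsPullback.isoPullback_hom_snd_assoc]
  let F (c : Bool) : (coverOfTwo u v h).X c ⟶ P := match c with | true => a | false => b
  refine ⟨(coverOfTwo u v h).glueMorphisms F ?_, ?_, ?_⟩
  · rintro (_ | _) (_ | _)
    · exact congr($(show pullback.fst v v = pullback.snd v v by
        rw [← cancel_mono v, pullback.condition]) ≫ b)
    · change pullback.fst v u ≫ b = pullback.snd v u ≫ a
      rw [← cancel_epi (pullbackSymmetry u v).hom, pullbackSymmetry_hom_comp_fst_assoc,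
        pullbackSymmetry_hom_comp_snd_assoc, hfs]
    · exact hfs
    · exact congr($(show pullback.fst u u = pullback.snd u u by
        rw [← cancel_mono u, pullback.condition]) ≫ a)
  · exact Scheme.Cover.ι_glueMorphisms (coverOfTwo u v h) F _ true
  · exact Scheme.Cover.ι_glueMorphisms (coverOfTwo u v h) F _ false

lemma isPullback_snd_fst_of_isPullback {P₁ P U X B C : Scheme.{u}} {v₁ : P₁ ⟶ P} {i₁ : U ⟶ P₁}
    {i : X ⟶ P} {u : U ⟶ X} (hu : IsPullback i₁ u v₁ i) {f : X ⟶ C} {p : P ⟶ B} {c : C ⟶ B}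
    (hu' : IsPullback i₁ (u ≫ f) (v₁ ≫ p) c) :
    IsPullback (pullback.snd i v₁) (pullback.fst i v₁ ≫ f) (v₁ ≫ p) c :=
  IsPullback.of_iso hu' hu.flip.isoPullback (Iso.refl _) (Iso.refl _) (Iso.refl _)
    (by rw [Iso.refl_hom, Category.comp_id, hu.flip.isoPullback_hom_snd])
    (by rw [Iso.refl_hom, Category.comp_id, hu.flip.isoPullback_hom_fst_assoc])
    (by rw [Iso.refl_hom, Iso.refl_hom, Category.comp_id, Category.id_comp])
    (by rw [Iso.refl_hom, Iso.refl_hom, Category.comp_id, Category.id_comp])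

/-- Being Cartesian is local on `P`; `hu` and `hv` identify the restrictions of `X` to the two
pieces with `U` and `V`. -/
lemma isPullback_of_coverOfTwo {P₁ P₂ P U V X B C : Scheme.{u}} {v₁ : P₁ ⟶ P} {v₂ : P₂ ⟶ P}
    [IsOpenImmersion v₁] [IsOpenImmersion v₂] (h : ∀ x : P, x ∈ Set.range v₁ ∨ x ∈ Set.range v₂)
    {i₁ : U ⟶ P₁} {i₂ : V ⟶ P₂} {i : X ⟶ P} {u : U ⟶ X} {v : V ⟶ X}
    (hu : IsPullback i₁ u v₁ i) (hv : IsPullback i₂ v v₂ i) {f : X ⟶ C} {p : P ⟶ B} {c : C ⟶ B}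
    (hu' : IsPullback i₁ (u ≫ f) (v₁ ≫ p) c) (hv' : IsPullback i₂ (v ≫ f) (v₂ ≫ p) c) :
    IsPullback i f p c := by
  refine Scheme.isPullback_of_openCover i f p c (coverOfTwo v₁ v₂ h) ?_
  rintro (_ | _)
  · exact isPullback_snd_fst_of_isPullback hv hv'
  · exact isPullback_snd_fst_of_isPullback hu hu'

end Glue

/-! ### Gluing models -/

namespace Model

variable {A : CommRingCat.{u}} {R : CommRingCat.{u}} {a : R ⟶ A}

/-- Both models are Cartesian over the same `a`, so the square between them is Cartesian by
cancellation. -/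
lemma isPullback_of_hom {Y W : Scheme.{u}} {f : Y ⟶ Spec A} {g : W ⟶ Spec A} {w : W ⟶ Y}
    (hw : w ≫ f = g) (N : Model g a) (M : Model f a) (j : N.X ⟶ M.X) (hj : j ≫ M.x = N.x)
    (h : N.i ≫ j = w ≫ M.i) : IsPullback N.i w j M.i :=
  IsPullback.of_bot (by simpa only [hj, hw] using N.isPullback) h M.isPullback

lemma isPullback_map {Y Y' : Scheme.{u}} {f : Y ⟶ Spec A} {g : Y' ⟶ Spec A} (M : Model f a)
    (N : Model g a) (m : M.X ⟶ N.X) (hm : m ≫ N.x = M.x) (s : FiniteFactorization a) :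
    IsPullback (M.proj s) (M.map N m hm s) m (N.proj s) :=
  IsPullback.of_bot (by simpa only [map_x, hm] using M.isPullback_fst s.q s.p s.fac)
    (map_proj _ _ _ _ _).symm (N.isPullback_fst s.q s.p s.fac)

/-- The model of an open subscheme induced by an open subscheme of a model. -/
@[simps X x i] noncomputable def restrict {Y : Scheme.{u}} {f : Y ⟶ Spec A} [IsNoetherianRing R]
    (M : Model f a) (O : M.X.Opens) : Model ((M.i ⁻¹ᵁ O).ι ≫ f) a where
  X := O
  x := O.ι ≫ M.x
  i := M.i ∣_ O
  isPullback := (isPullback_morphismRestrict M.i O).paste_vert M.isPullback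
  locallyOfFiniteType := inferInstance
  quasiCompact := by
    have := M.isNoetherian
    have : CompactSpace O := isCompact_iff_compactSpace.mp
      (TopologicalSpace.NoetherianSpace.isCompact (O : Set M.X))
    infer_instance

variable {X U V : Scheme.{u}} {f : X ⟶ Spec A} {u : U ⟶ X} {v : V ⟶ X} [IsOpenImmersion u]
  [IsOpenImmersion v]

/-- Models of two open subschemes with isomorphic overlaps glue. -/
theorem nonempty_of_overlap (h : ∀ x : X, x ∈ Set.range u ∨ x ∈ Set.range v)
    (M : Model (u ≫ f) a) (M' : Model (v ≫ f) a) {W N : Scheme.{u}} {w : W ⟶ U} {w' : W ⟶ V}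
    (hW : IsPullback w w' u v) (n : W ⟶ N) (j : N ⟶ M.X) (j' : N ⟶ M'.X) [IsOpenImmersion j]
    [IsOpenImmersion j'] (hj : j ≫ M.x = j' ≫ M'.x) (hn : IsPullback n w j M.i)
    (hn' : IsPullback n w' j' M'.i) : Nonempty (Model f a) := by
  obtain ⟨P, t, t', ht, ht', hP, hPc, hPi⟩ := exists_isPushout_of_isOpenImmersion j j'
  let p : P ⟶ Spec R := hP.desc M.x M'.x hj
  have hp : t ≫ p = M.x := hP.inl_desc ..
  have hp' : t' ≫ p = M'.x := hP.inr_desc ..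
  obtain ⟨i, hi, hi'⟩ := exists_glue_of_isPullback hW h (M.i ≫ t) (M'.i ≫ t') (by
    rw [← hn.w_assoc, ← hn'.w_assoc, hP.w])
  -- Only the preimage of the first piece has to be computed: a point of `V` landing there lies in
  -- the glued overlap, and `hn'` lifts it to `W`, hence to `U`.
  have hu : IsPullback M.i u t i := by
    refine IsOpenImmersion.isPullback _ _ _ _ hi (le_antisymm ?_ ?_)
    · rintro x ⟨y, hy⟩
      obtain ⟨z, rfl⟩ | ⟨z, rfl⟩ := h x
      · exact ⟨z, rfl⟩
      · have : t y = t' (M'.i z) := hy.trans congr($hi' z)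
        obtain ⟨m, -, hm⟩ := hPi _ _ this
        obtain ⟨q, -, hq⟩ := Scheme.exists_preimage_of_isPullback hn' m z hm
        exact ⟨w q, by rw [← hq]; exact congr($hW.w q)⟩
    · rintro _ ⟨z, rfl⟩
      exact ⟨M.i z, congr($hi z).symm⟩
  have hv : IsPullback M'.i v t' i := by
    refine IsOpenImmersion.isPullback _ _ _ _ hi' (le_antisymm ?_ ?_)
    · rintro x ⟨y, hy⟩
      obtain ⟨z, rfl⟩ | ⟨z, rfl⟩ := h x
      · have : t (M.i z) = t' y := (hy.trans congr($hi z)).symm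
        obtain ⟨m, hm, -⟩ := hPi _ _ this
        obtain ⟨q, -, hq⟩ := Scheme.exists_preimage_of_isPullback hn m z hm
        exact ⟨w' q, by rw [← hq]; exact congr($hW.w q).symm⟩
      · exact ⟨z, rfl⟩
    · rintro _ ⟨z, rfl⟩
      exact ⟨M'.i z, congr($hi' z).symm⟩
  refine ⟨⟨P, p, i, isPullback_of_coverOfTwo hPc hu hv (by rw [hp]; exact M.isPullback)
    (by rw [hp']; exact M'.isPullback), ?_, ?_⟩⟩
  · have : IsZariskiLocalAtSource (@LocallyOfFiniteType.{u}) :=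
      HasRingHomProperty.instIsZariskiLocalAtSource
    refine IsZariskiLocalAtSource.of_openCover (P := @LocallyOfFiniteType.{u})
      (coverOfTwo t t' hPc) ?_
    rintro (_ | _)
    · exact (hp' ▸ M'.locallyOfFiniteType :)
    · exact (hp ▸ M.locallyOfFiniteType :)
  · have : CompactSpace M.X := QuasiCompact.compactSpace_of_compactSpace M.x
    have : CompactSpace M'.X := QuasiCompact.compactSpace_of_compactSpace M'.x
    have : CompactSpace P := by
      refine ⟨?_⟩
      have : (Set.univ : Set P) = Set.range t ∪ Set.range t' := by
        ext x; simpa using hPc x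
      rw [this]
      exact (isCompact_range t.continuous).union (isCompact_range t'.continuous)
    infer_instance

/-- Models of two open subschemes glue, provided that their intersection descends to both. -/
theorem exists_of_opens [IsNoetherianRing R]
    (h : ∀ x : X, x ∈ Set.range u ∨ x ∈ Set.range v) (M : Model (u ≫ f) a)
    (M' : Model (v ≫ f) a) (O : M.X.Opens) (O' : M'.X.Opens)
    (hO : M.i ⁻¹ᵁ O = u ⁻¹ᵁ v.opensRange) (hO' : M'.i ⁻¹ᵁ O' = v ⁻¹ᵁ u.opensRange) :
    ∃ s : FiniteFactorization a, Nonempty (Model f s.p) := by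
  have hr : Set.range ((M.i ⁻¹ᵁ O).ι ≫ u) = Set.range ((M'.i ⁻¹ᵁ O').ι ≫ v) := by
    rw [hO, hO']
    ext x
    constructor
    · rintro ⟨⟨y, z, hz⟩, rfl⟩
      exact ⟨⟨z, y, hz.symm⟩, hz⟩
    · rintro ⟨⟨y, z, hz⟩, rfl⟩
      exact ⟨⟨z, y, hz.symm⟩, hz⟩
  -- Both opens are the intersection of `U` and `V` in `X`, so `O` and `O'` are two models of it.
  -- Descending `e` identifies them at a finite level and supplies the gluing datum.
  let e := IsOpenImmersion.isoOfRangeEq _ _ hr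
  have he : e.hom ≫ (M'.i ⁻¹ᵁ O').ι ≫ v = (M.i ⁻¹ᵁ O).ι ≫ u :=
    IsOpenImmersion.isoOfRangeEq_hom_fac ..
  obtain ⟨s, e', h₁, h₂⟩ := (M.restrict O).exists_iso (M'.restrict O') e
    (by rw [← Category.assoc (Scheme.Opens.ι _), ← Category.assoc, he, Category.assoc])
  let m := (M.restrict O).map M O.ι rfl s
  let m' := (M'.restrict O').map M' O'.ι rfl s
  have hm : IsOpenImmersion m :=
    MorphismProperty.of_isPullback (isPullback_map (M.restrict O) M O.ι rfl s)
      (inferInstance : IsOpenImmersion O.ι)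
  have hm' : IsOpenImmersion m' :=
    MorphismProperty.of_isPullback (isPullback_map (M'.restrict O') M' O'.ι rfl s)
      (inferInstance : IsOpenImmersion O'.ι)
  have hmx : m ≫ (M.at' s).x = ((M.restrict O).at' s).x := map_x ..
  have hmx' : m' ≫ (M'.at' s).x = ((M'.restrict O').at' s).x := map_x ..
  have him : ((M.restrict O).at' s).i ≫ m = (M.i ⁻¹ᵁ O).ι ≫ (M.at' s).i :=
    i_map _ _ _ _ _ rfl (morphismRestrict_ι M.i O)
  have him' : ((M'.restrict O').at' s).i ≫ m' = (M'.i ⁻¹ᵁ O').ι ≫ (M'.at' s).i :=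
    i_map _ _ _ _ _ rfl (morphismRestrict_ι M'.i O')
  have hW : IsPullback (M.i ⁻¹ᵁ O).ι (e.hom ≫ (M'.i ⁻¹ᵁ O').ι) u v := by
    refine (IsOpenImmersion.isPullback _ _ _ _ (by rw [Category.assoc, he]) ?_).flip
    rw [Scheme.Opens.opensRange_ι, hO]
  refine ⟨s, nonempty_of_overlap h (M.at' s) (M'.at' s) hW ((M.restrict O).at' s).i m
    (e'.hom ≫ m') ?_ ?_ ?_⟩
  · rw [Category.assoc, hmx, hmx', h₁]
  · exact isPullback_of_hom rfl _ _ _ hmx him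
  · refine isPullback_of_hom ?_ _ _ _ ?_ ?_
    · rw [Category.assoc, ← Category.assoc (Scheme.Opens.ι _), ← Category.assoc, he, Category.assoc]
    · rw [Category.assoc, hmx', h₁]
    · rw [← Category.assoc, h₂, Category.assoc, him', Category.assoc]

/-- Models of two open subschemes glue at a finite level. -/
theorem exists_of_cover [IsNoetherianRing R] [IsNoetherian X]
    (h : ∀ x : X, x ∈ Set.range u ∨ x ∈ Set.range v) (M : Model (u ≫ f) a)
    (M' : Model (v ≫ f) a) : ∃ s : FiniteFactorization a, Nonempty (Model f s.p) := by
  have := u.isOpenEmbedding.isInducing.noetherianSpace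
  have := v.isOpenEmbedding.isInducing.noetherianSpace
  obtain ⟨s, O, hO⟩ := M.exists_opens (u ⁻¹ᵁ v.opensRange)
    (TopologicalSpace.NoetherianSpace.isCompact _)
  obtain ⟨t, O', hO'⟩ := (M'.at' s).exists_opens (v ⁻¹ᵁ u.opensRange)
    (TopologicalSpace.NoetherianSpace.isCompact _)
  have := s.isNoetherianRing
  have := t.isNoetherianRing
  obtain ⟨r, ⟨N⟩⟩ := exists_of_opens h ((M.at' s).at' t) ((M'.at' s).at' t)
    ((M.at' s).proj t ⁻¹ᵁ O) O' (by rw [← Scheme.Hom.comp_preimage, i_fst, hO]) hO'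
  exact ⟨(s.trans t).trans r, ⟨N⟩⟩

end Model

/-! ### Existence of models for schemes of finite type -/

namespace Model

variable {A : CommRingCat.{u}} {R : CommRingCat.{u}}

/-- Transport of a model along an isomorphism. -/
@[simps X x i] noncomputable def ofIso {a : R ⟶ A} {Y Y' : Scheme.{u}} {f : Y ⟶ Spec A}
    {g : Y' ⟶ Spec A}
    (M : Model f a) (e : Y' ≅ Y) (he : e.hom ≫ f = g) : Model g a where
  X := M.X
  x := M.x
  i := e.hom ≫ M.i
  isPullback := M.isPullback.of_iso e.symm (Iso.refl _) (Iso.refl _) (Iso.refl _) (by simp)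
    (by simp [← he]) (by simp) (by simp)
  locallyOfFiniteType := inferInstance
  quasiCompact := inferInstance

/-- The model associated with a finite type algebra over the base. -/
@[simps X x i] noncomputable def ofIsPushout {a : R ⟶ A} {B D : CommRingCat.{u}} {b : A ⟶ B}
    {d : R ⟶ D}
    {e : D ⟶ B} (h : IsPushout a d b e) (hd : d.hom.FiniteType) : Model (Spec.map b) a where
  X := Spec D
  x := Spec.map d
  i := Spec.map e
  isPullback := (isPullback_SpecMap_of_isPushout _ _ _ _ h).flip
  locallyOfFiniteType := (HasRingHomProperty.Spec_iff (P := @LocallyOfFiniteType)).mpr hd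
  quasiCompact := inferInstance

/-- Finitely presented algebras descend. -/
theorem exists_of_finitePresentation (a : R ⟶ A) {B : CommRingCat.{u}} (b : A ⟶ B)
    (hb : b.hom.FinitePresentation) :
    ∃ (s : FiniteFactorization a) (D : CommRingCat.{u}) (d : s.ring ⟶ D) (e : D ⟶ B),
      IsPushout s.p d b e ∧ d.hom.FiniteType := by
  let := a.hom.toAlgebra
  let := b.hom.toAlgebra
  have : Algebra.FinitePresentation A B := hb
  let P := Algebra.Presentation.ofFinitePresentation A B
  -- Only the finitely many coefficients of the relations matter: over the subalgebra they generate,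
  -- the same presentation defines the descended algebra.
  let C : FGSubalgebra R A := ⟨Algebra.adjoin R P.coeffs, ⟨P.finite_coeffs.toFinset, by simp⟩⟩
  have : P.HasCoeffs C.1 := ⟨fun x hx ↦ ⟨⟨x, Algebra.subset_adjoin hx⟩, rfl⟩⟩
  refine ⟨.ofSubalgebra a C, .of (P.ModelOfHasCoeffs C.1),
    CommRingCat.ofHom (algebraMap C.1 (P.ModelOfHasCoeffs C.1)),
    CommRingCat.ofHom ((P.tensorModelOfHasCoeffsEquiv C.1).toAlgHom.toRingHom.comp
      Algebra.TensorProduct.includeRight.toRingHom), ?_, ?_⟩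
  · refine (CommRingCat.isPushout_tensorProduct C.1 A (P.ModelOfHasCoeffs C.1)).of_iso (Iso.refl _)
      (Iso.refl _) (Iso.refl _) (P.tensorModelOfHasCoeffsEquiv C.1).toRingEquiv.toCommRingCatIso
      rfl rfl ?_ rfl
    ext x
    change P.tensorModelOfHasCoeffsEquiv C.1 (x ⊗ₜ 1) = b x
    exact (P.tensorModelOfHasCoeffsEquiv C.1).commutes x
  · have : Algebra.FiniteType C.1 (P.ModelOfHasCoeffs C.1) := inferInstance
    exact RingHom.finiteType_algebraMap.mpr this

/-- Affine schemes of finite presentation descend to affine schemes. -/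
theorem exists_of_isAffine (a : R ⟶ A) {Y : Scheme.{u}} [IsAffine Y] (f : Y ⟶ Spec A)
    [LocallyOfFinitePresentation f] :
    ∃ (s : FiniteFactorization a) (M : Model f s.p), IsAffine M.X := by
  obtain ⟨b, hb⟩ : ∃ b : A ⟶ Γ(Y, ⊤), Y.isoSpec.hom ≫ Spec.map b = f := by
    refine ⟨Spec.preimage (Y.isoSpec.inv ≫ f), ?_⟩
    simp
  have : LocallyOfFinitePresentation (Spec.map b) := by
    rw [← Iso.eq_inv_comp] at hb
    rw [hb]
    infer_instance
  obtain ⟨s, D, d, e, h, hd⟩ := exists_of_finitePresentation a b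
    ((HasRingHomProperty.Spec_iff (P := @LocallyOfFinitePresentation)).mp this)
  exact ⟨s, (ofIsPushout h hd).ofIso Y.isoSpec hb, inferInstanceAs (IsAffine (Spec D))⟩

/-- Schemes of finite type over a noetherian ring descend. -/
theorem exists_of_finiteType [IsNoetherianRing R] [IsNoetherianRing A] (a : R ⟶ A) {Y : Scheme.{u}}
    (f : Y ⟶ Spec A) [LocallyOfFiniteType f] [QuasiCompact f] :
    ∃ s : FiniteFactorization a, Nonempty (Model f s.p) := by
  have : CompactSpace Y := QuasiCompact.compactSpace_of_compactSpace f
  have : IsLocallyNoetherian Y := LocallyOfFiniteType.isLocallyNoetherian f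
  have : IsNoetherian Y := {}
  -- The base ring stays arbitrary because the induction, which adds one affine open at a time,
  -- applies this over the stage already reached.
  have aff (U : Y.Opens) (hU : IsAffineOpen U) (R : CommRingCat.{u}) (a : R ⟶ A) :
      ∃ s : FiniteFactorization a, Nonempty (Model (U.ι ≫ f) s.p) := by
    have : IsAffine U := hU
    have : LocallyOfFinitePresentation (U.ι ≫ f) :=
      LocallyOfFinitePresentation.iff_locallyOfFiniteType.mpr inferInstance
    obtain ⟨s, M, -⟩ := exists_of_isAffine a (U.ι ≫ f)
    exact ⟨s, ⟨M⟩⟩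
  suffices ∃ s : FiniteFactorization a, Nonempty (Model ((⊤ : Y.Opens).ι ≫ f) s.p) by
    obtain ⟨s, ⟨M⟩⟩ := this
    exact ⟨s, ⟨M.ofIso Y.topIso.symm (by simp)⟩⟩
  refine compact_open_induction_on (P := fun U ↦ ∃ s : FiniteFactorization a,
    Nonempty (Model (U.ι ≫ f) s.p)) ⊤ isCompact_univ (aff _ (isAffineOpen_bot Y) R a) ?_
  rintro S - U ⟨s, ⟨M⟩⟩
  obtain ⟨t, ⟨N⟩⟩ := aff U U.2 _ s.p
  have := s.isNoetherianRing
  have := t.isNoetherianRing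
  have : IsNoetherian ↑(S ⊔ U.1) := by
    have := (S ⊔ U.1).ι.isOpenEmbedding.isInducing.noetherianSpace
    have := isLocallyNoetherian_of_isOpenImmersion (S ⊔ U.1).ι
    exact {}
  obtain ⟨r, ⟨K⟩⟩ := exists_of_cover (f := (S ⊔ U.1).ι ≫ f)
    (u := Y.homOfLE (le_sup_left : S ≤ S ⊔ U.1)) (v := Y.homOfLE (le_sup_right : U.1 ≤ S ⊔ U.1)) (by
      rintro ⟨x, hx | hx⟩
      · exact Or.inl ⟨⟨x, hx⟩, Subtype.ext (by simp)⟩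
      · exact Or.inr ⟨⟨x, hx⟩, Subtype.ext (by simp)⟩)
    ((M.at' t).ofIso (Iso.refl _) (by simp)) (N.ofIso (Iso.refl _) (by simp))
  exact ⟨(s.trans t).trans r, ⟨K⟩⟩

end Model

/-! ### Maximal ideals avoiding a countable subring -/

/-- An extension of an uncountable field that is countably generated as an algebra is algebraic. -/
theorem Algebra.IsAlgebraic.of_adjoin_countable {k K : Type*} [Field k] [Uncountable k] [Field K]
    [Algebra k K] {s : Set K} (hs : s.Countable) (h : Algebra.adjoin k s = ⊤) :
    Algebra.IsAlgebraic k K := by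
  refine ⟨fun x ↦ by_contra fun hx ↦ ?_⟩
  have hx : Transcendental k x := hx
  -- The elements `(x - c)⁻¹` for `c` in `k` are linearly independent when `x` is transcendental,
  -- whereas a countably generated algebra has dimension at most `ℵ₀`.
  have h1 := hx.linearIndependent_sub_inv.cardinal_lift_le_rank
  have h2 := Algebra.rank_adjoin_le (R := k) s
  rw [h, Subalgebra.topEquiv.toLinearEquiv.rank_eq, max_eq_right
    (Cardinal.le_aleph0_iff_set_countable.mpr hs)] at h2
  have h3 := h1.trans (Cardinal.lift_le.mpr h2)
  rw [Cardinal.lift_aleph0, Cardinal.lift_le_aleph0, Cardinal.mk_le_aleph0_iff] at h3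
  exact not_countable h3

/-- A domain of finite type over an uncountable field has a maximal ideal that meets a given
countable subring only in zero. -/
theorem exists_isMaximal_comap_eq_bot (k : Type*) {A R : Type*} [Field k] [Uncountable k]
    [CommRing A] [IsDomain A] [Algebra k A] [Algebra.FiniteType k A] [CommRing R] [Countable R]
    (a : R →+* A) (ha : Function.Injective a) :
    ∃ m : Ideal A, m.IsMaximal ∧ m.comap a = ⊥ := by
  have : IsDomain R := ha.isDomain a
  let M : Submonoid A := (nonZeroDivisors R).map a
  have hM : M ≤ nonZeroDivisors A := map_le_nonZeroDivisors_of_injective a ha le_rfl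
  let B := Localization M
  have : IsDomain B := IsLocalization.isDomain_localization hM
  obtain ⟨n, hn⟩ := Ideal.exists_maximal B
  let K := B ⧸ n
  let := Ideal.Quotient.field n
  obtain ⟨t, ht⟩ := (inferInstance : Algebra.FiniteType k A)
  let ψ : A →ₐ[k] K := (Ideal.Quotient.mkₐ k n).comp (IsScalarTower.toAlgHom k A B)
  -- Generators of `K`: those of `A`, which are finitely many, and the inverses of the countably
  -- many elements of `R`.
  let s : Set K := ψ '' t ∪ Set.range (fun r : R ↦ (ψ (a r))⁻¹)
  have hs : s.Countable := (t.countable_toSet.image _).union (Set.countable_range _)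
  have hψ (x : A) : ψ x ∈ Algebra.adjoin k s := by
    have : ψ x ∈ (⊤ : Subalgebra k A).map ψ := ⟨x, trivial, rfl⟩
    rw [← ht, AlgHom.map_adjoin] at this
    exact Algebra.adjoin_mono Set.subset_union_left this
  have htop : Algebra.adjoin k s = ⊤ := by
    refine top_le_iff.mp fun y _ ↦ ?_
    obtain ⟨b, rfl⟩ := Ideal.Quotient.mk_surjective y
    obtain ⟨x, ⟨_, r, hr, rfl⟩, rfl⟩ := IsLocalization.exists_mk'_eq M b
    have hmem : (ψ (a r))⁻¹ ∈ Algebra.adjoin k s :=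
      Algebra.subset_adjoin (Or.inr ⟨r, rfl⟩)
    convert mul_mem (hψ x) hmem
    have hu : IsUnit (ψ (a r)) :=
      (IsLocalization.map_units (M := M) B ⟨a r, Submonoid.mem_map_of_mem a hr⟩).map
        (Ideal.Quotient.mk n)
    rw [eq_mul_inv_iff_mul_eq₀ hu.ne_zero]
    change Ideal.Quotient.mk n _ * Ideal.Quotient.mk n (algebraMap A B (a r)) =
      Ideal.Quotient.mk n (algebraMap A B x)
    rw [← map_mul]
    exact congr_arg _ (IsLocalization.mk'_spec (M := M) B x ⟨a r, Submonoid.mem_map_of_mem a hr⟩)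
  have halg : Algebra.IsAlgebraic k K := .of_adjoin_countable hs htop
  refine ⟨RingHom.ker ψ, ?_, ?_⟩
  -- The image of `A` is a domain integral over `k`, hence a field, so the kernel is maximal.
  · have : Algebra.IsIntegral k ψ.range := ⟨fun x ↦ by
      have := (Algebra.IsIntegral.isIntegral (R := k) (x : K))
      exact (isIntegral_algHom_iff ψ.range.val Subtype.val_injective).mp this⟩
    have hf : IsField ψ.range := isField_of_isIntegral_of_isField' (Field.toIsField k)
    have : IsField (A ⧸ RingHom.ker ψ) :=
      (Ideal.quotientKerEquivRange ψ).toMulEquiv.isField hf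
    exact Ideal.Quotient.maximal_of_isField _ this
  -- A nonzero element of `R` is a unit in `B`, so it cannot die in `K`.
  · refine (Submodule.eq_bot_iff _).mpr fun r hr ↦ by_contra fun h0 ↦ ?_
    have hu : IsUnit (ψ (a r)) :=
      (IsLocalization.map_units (M := M) B ⟨a r, Submonoid.mem_map_of_mem a
        (mem_nonZeroDivisors_of_ne_zero h0)⟩).map
        (Ideal.Quotient.mk n)
    exact hu.ne_zero hr

/-! ### Reducedness of the base of a cylinder, base change and descent of cylinders -/

/-- A scheme is reduced if it is a retract of a reduced scheme. -/
lemma isReduced_of_retract {X Y : Scheme.{u}} (i : X ⟶ Y) (r : Y ⟶ X) (h : i ≫ r = 𝟙 X)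
    [IsReduced Y] :
    IsReduced X := by
  refine ⟨fun U ↦ isReduced_of_injective (r.app U).hom fun x y hxy ↦ ?_⟩
  have h1 := Scheme.Hom.congr_app h U
  rw [Scheme.Hom.comp_app, Scheme.Hom.id_app] at h1
  have h2 : ((r.app U ≫ i.app (r ⁻¹ᵁ U))).hom x = ((r.app U ≫ i.app (r ⁻¹ᵁ U))).hom y :=
    congrArg (i.app (r ⁻¹ᵁ U)).hom hxy
  rw [h1] at h2
  have e : (i ≫ r) ⁻¹ᵁ U = U := by simp [h]
  exact (ConcreteCategory.bijective_of_isIso (X.presheaf.map (eqToHom e).op)).1 h2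

/-- The zero section makes `Z` a retract of its affine space. -/
lemma isReduced_of_affineSpace (Z : Scheme.{u}) {n : Type u} [IsReduced 𝔸(n; Z)] : IsReduced Z :=
  isReduced_of_retract (AffineSpace.homOfVector (𝟙 Z) 0) (𝔸(n; Z) ↘ Z)
    (AffineSpace.homOfVector_over _ _)

/-- Base change of an open embedding of a cylinder. -/
lemma exists_affineSpace_baseChange {n : Type u} {X X' B B' Z Z' : Scheme.{u}} {f : X ⟶ B}
    {f' : X' ⟶ B'}
    {x : X' ⟶ X} {b : B' ⟶ B} {p : Z ⟶ B} {p' : Z' ⟶ B'} {z : Z' ⟶ Z} (hX : IsPullback x f' f b)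
    (hZ : IsPullback z p' p b) (φ : 𝔸(n; Z) ⟶ X) [IsOpenImmersion φ]
    (w : φ ≫ f = (𝔸(n; Z) ↘ Z) ≫ p) :
    ∃ φ' : 𝔸(n; Z') ⟶ X', IsOpenImmersion φ' ∧ φ' ≫ f' = (𝔸(n; Z') ↘ Z') ≫ p' := by
  have h : IsPullback (AffineSpace.map n z) ((𝔸(n; Z') ↘ Z') ≫ p') ((𝔸(n; Z) ↘ Z) ≫ p) b :=
    (AffineSpace.isPullback_map z).paste_vert hZ
  let φ' : 𝔸(n; Z') ⟶ X' := hX.lift (AffineSpace.map n z ≫ φ) ((𝔸(n; Z') ↘ Z') ≫ p') (by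
    rw [Category.assoc, w, h.w])
  have h' : IsPullback (AffineSpace.map n z) φ' φ x :=
    IsPullback.of_bot (by rw [hX.lift_snd, w]; exact h) (hX.lift_fst _ _ _).symm hX
  exact ⟨φ', MorphismProperty.of_isPullback h' ‹_›, hX.lift_snd _ _ _⟩

namespace Model

variable {A R : CommRingCat.{u}} {a : R ⟶ A}

/-- The affine space over a model. -/
@[simps X x i] noncomputable def affineSpace {Y : Scheme.{u}} {f : Y ⟶ Spec A} (M : Model f a)
    (n : Type u)
    [Finite n] : Model ((𝔸(n; Y) ↘ Y) ≫ f) a where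
  X := 𝔸(n; M.X)
  x := (𝔸(n; M.X) ↘ M.X) ≫ M.x
  i := AffineSpace.map n M.i
  isPullback := (AffineSpace.isPullback_map M.i).paste_vert M.isPullback
  locallyOfFiniteType := inferInstance
  quasiCompact := inferInstance

/-- Base change of a model along a morphism to the larger base. -/
@[simps X x i] noncomputable def ofIsPullback {A' : CommRingCat.{u}} {Y Y' : Scheme.{u}}
    {f : Y ⟶ Spec A}
    (M : Model f a) {y : Y' ⟶ Y} {g : Y' ⟶ Spec A'} {t : A ⟶ A'} (h : IsPullback y g f (Spec.map t)) :
    Model g (a ≫ t) where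
  X := M.X
  x := M.x
  i := y ≫ M.i
  isPullback := by
    rw [Spec.map_comp]
    exact h.flip.paste_vert M.isPullback.flip |>.flip
  locallyOfFiniteType := inferInstance
  quasiCompact := inferInstance

/-- Cylinders descend to a finite level. -/
theorem exists_cylinder [IsNoetherianRing R] [IsNoetherianRing A] {Y : Scheme.{u}} {f : Y ⟶ Spec A}
    (M : Model f a)
    {n : Type u} [Finite n] {Z : Scheme.{u}} [IsAffine Z] (p : Z ⟶ Spec A) [LocallyOfFiniteType p]
    (φ : 𝔸(n; Z) ⟶ Y) [IsOpenImmersion φ] (w : φ ≫ f = (𝔸(n; Z) ↘ Z) ≫ p) :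
    ∃ (s : FiniteFactorization a) (N : Model p s.p) (P : Scheme.{u}) (y : P ⟶ M.X)
      (g : P ⟶ Spec s.ring) (φ' : 𝔸(n; N.X) ⟶ P), IsAffine N.X ∧ IsPullback y g M.x (Spec.map s.q) ∧
        IsOpenImmersion φ' ∧ φ' ≫ g = (𝔸(n; N.X) ↘ N.X) ≫ N.x := by
  have : LocallyOfFinitePresentation p :=
    LocallyOfFinitePresentation.iff_locallyOfFiniteType.mpr inferInstance
  obtain ⟨s, N, hN⟩ := exists_of_isAffine a p
  have : IsLocallyNoetherian Z := LocallyOfFiniteType.isLocallyNoetherian p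
  have : IsLocallyNoetherian 𝔸(n; Z) := LocallyOfFiniteType.isLocallyNoetherian (𝔸(n; Z) ↘ Z)
  obtain ⟨t, V, hV⟩ := (M.at' s).exists_opens φ.opensRange (isCompact_range φ.continuous)
  have := s.isNoetherianRing
  have := t.isNoetherianRing
  let M' := ((M.at' s).at' t).restrict V
  let N' := N.at' t
  -- The embedding is thus an isomorphism onto an open that already descends to `V`. Source and
  -- target both have models, so it descends as an isomorphism and not merely as a morphism.
  let e := IsOpenImmersion.isoOfRangeEq φ (((M.at' s).at' t).i ⁻¹ᵁ V).ι (by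
    rw [hV, Scheme.Opens.range_ι]; rfl)
  have he : e.hom ≫ (((M.at' s).at' t).i ⁻¹ᵁ V).ι = φ := IsOpenImmersion.isoOfRangeEq_hom_fac ..
  obtain ⟨r, e', h₁, -⟩ := (N'.affineSpace n).exists_iso M' e (by
    rw [← Category.assoc, he, w])
  let m : (M'.at' r).X ⟶ (((M.at' s).at' t).at' r).X := M'.map ((M.at' s).at' t) V.ι rfl r
  have hm : IsOpenImmersion m :=
    MorphismProperty.of_isPullback (isPullback_map M' ((M.at' s).at' t) V.ι rfl r)
      (inferInstance : IsOpenImmersion V.ι)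
  have hmx : m ≫ (((M.at' s).at' t).at' r).x = (M'.at' r).x := map_x ..
  let N'' := N'.at' r
  have hN' : IsPullback (AffineSpace.map n (N'.proj r)) ((𝔸(n; N''.X) ↘ N''.X) ≫ N''.x)
      ((𝔸(n; N'.X) ↘ N'.X) ≫ N'.x) (Spec.map r.q) :=
    (AffineSpace.isPullback_map (N'.proj r)).paste_vert (N'.isPullback_fst _ _ _)
  -- Affine space commutes with base change, so the source of the descended isomorphism is the
  -- affine space over the base-changed model.
  let d : 𝔸(n; N''.X) ≅ ((N'.affineSpace n).at' r).X :=
    IsPullback.isoIsPullback _ _ hN' ((N'.affineSpace n).isPullback_fst r.q r.p r.fac)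
  have hd : d.hom ≫ ((N'.affineSpace n).at' r).x = (𝔸(n; N''.X) ↘ N''.X) ≫ N''.x :=
    IsPullback.isoIsPullback_hom_snd _ _ _ _
  refine ⟨(s.trans t).trans r, N'', (((M.at' s).at' t).at' r).X,
    (((M.at' s).at' t).proj r ≫ (M.at' s).proj t) ≫ M.proj s, (((M.at' s).at' t).at' r).x,
    d.hom ≫ e'.hom ≫ m, ?_, ?_, inferInstance, ?_⟩
  · have : IsAffineHom (N'.proj r ≫ N.proj t) := inferInstance
    exact isAffine_of_isAffineHom (N'.proj r ≫ N.proj t)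
  · have h1 := (((M.at' s).at' t).isPullback_fst r.q r.p r.fac).paste_horiz
      ((M.at' s).isPullback_fst t.q t.p t.fac) |>.paste_horiz (M.isPullback_fst s.q s.p s.fac)
    rwa [← Spec.map_comp, ← Spec.map_comp, ← Category.assoc] at h1
  · rw [Category.assoc, Category.assoc, hmx, h₁, hd]

end Model

/-! ### Points in finite and in generically étale extensions -/

open TensorProduct in
/-- Two fields containing a common ring embed into a common field. -/
lemma exists_field_comp_eq {R F F' : Type u} [CommRing R] [Field F] [Field F'] (a : R →+* F)
    (b : R →+* F') (ha : Function.Injective a) (hb : Function.Injective b) :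
    ∃ (Ω : Type u) (_ : Field Ω) (i : F →+* Ω) (j : F' →+* Ω), i.comp a = j.comp b := by
  have : IsDomain R := ha.isDomain a
  let E := FractionRing R
  let := (IsFractionRing.lift (K := E) ha).toAlgebra
  let := (IsFractionRing.lift (K := E) hb).toAlgebra
  obtain ⟨n, hn⟩ := Ideal.exists_maximal (F ⊗[E] F')
  let := Ideal.Quotient.field n
  refine ⟨(F ⊗[E] F') ⧸ n, inferInstance,
    (Ideal.Quotient.mk n).comp Algebra.TensorProduct.includeLeftRingHom,
    (Ideal.Quotient.mk n).comp Algebra.TensorProduct.includeRight.toRingHom, ?_⟩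
  ext r
  have h1 : a r = algebraMap E F (algebraMap R E r) := (IsFractionRing.lift_algebraMap ha r).symm
  have h2 : b r = algebraMap E F' (algebraMap R E r) := (IsFractionRing.lift_algebraMap hb r).symm
  change Ideal.Quotient.mk n (a r ⊗ₜ 1) = Ideal.Quotient.mk n (1 ⊗ₜ b r)
  rw [h1, h2]
  generalize algebraMap R E r = e
  rw [Algebra.algebraMap_eq_smul_one, Algebra.algebraMap_eq_smul_one, TensorProduct.smul_tmul]

/-- Algebraic extensions of domains of characteristic zero are generically étale. -/
theorem exists_etale_localizationAway (A T : Type u) [CommRing A] [IsNoetherianRing A] [IsDomain A]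
    [CharZero A] [CommRing T] [IsDomain T] [Algebra A T] [FaithfulSMul A T] [Algebra.FiniteType A T]
    [Algebra.IsAlgebraic A T] : ∃ r : T, r ≠ 0 ∧ Algebra.Etale A (Localization.Away r) := by
  let E := FractionRing A
  let F := FractionRing T
  let : Algebra E F := FractionRing.liftAlgebra A F
  have : IsScalarTower A E F := FractionRing.isScalarTower_liftAlgebra A F
  have : Algebra.IsAlgebraic A F := (IsFractionRing.isAlgebraic_iff' A T F).mp inferInstance
  have : Algebra.IsAlgebraic E F := IsFractionRing.comap_isAlgebraic_iff.mp this
  have : CharZero E := charZero_of_injective_algebraMap (IsFractionRing.injective A E)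
  -- Characteristic zero makes the algebraic extension of fraction fields separable. Hence `T` is
  -- étale over `A` at its generic point, and therefore on a basic open neighborhood.
  have : Algebra.FormallyEtale E F := Algebra.FormallyEtale.of_isSeparable E F
  have : Algebra.FormallyEtale A E := Algebra.FormallyEtale.of_isLocalization (nonZeroDivisors A)
  have : Algebra.FormallyEtale A F := Algebra.FormallyEtale.comp A E F
  have hloc : IsLocalization (⊥ : Ideal T).primeCompl F := by
    have : (⊥ : Ideal T).primeCompl = nonZeroDivisors T := by
      ext; simp [Ideal.primeCompl]
    rw [this]
    infer_instance
  let e : F ≃ₐ[T] Localization.AtPrime (⊥ : Ideal T) :=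
    IsLocalization.algEquiv (⊥ : Ideal T).primeCompl _ _
  have : Algebra.IsEtaleAt A (⊥ : Ideal T) :=
    Algebra.FormallyEtale.of_equiv (e.restrictScalars A)
  have : Algebra.FinitePresentation A T := Algebra.FinitePresentation.of_finiteType.mp ‹_›
  exact Algebra.exists_etale_of_isEtaleAt (⊥ : Ideal T)

open TensorProduct in
/-- An algebra of finite type with a point over the generic point of the base has points with
values in a finite extension of the function field, and in a generically étale extension of the
base. -/
theorem exists_finite_and_exists_etale {A : Type u} (L : Type u) [CommRing A] [IsNoetherianRing A]
    [IsDomain A]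
    [CharZero A] [Field L] [Algebra A L] [IsFractionRing A L] {D : Type u} [CommRing D]
    [Algebra A D] [Algebra.FiniteType A D] {Ω : Type u} [Field Ω] (ψ : D →+* Ω)
    (hψ : Function.Injective (ψ.comp (algebraMap A D))) :
    (∃ (L' : Type u) (_ : Field L') (_ : Algebra L L') (d : D →+* L'), FiniteDimensional L L' ∧
      d.comp (algebraMap A D) = (algebraMap L L').comp (algebraMap A L)) ∧
    ∃ (T : Type u) (_ : CommRing T) (_ : IsDomain T) (_ : Algebra A T) (d : D →+* T),
      Algebra.Etale A T ∧ d.comp (algebraMap A D) = algebraMap A T := by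
  let := (IsFractionRing.lift (K := L) hψ).toAlgebra
  let := ψ.toAlgebra
  let : Algebra A Ω := (ψ.comp (algebraMap A D)).toAlgebra
  have : IsScalarTower A D Ω := .of_algebraMap_eq' rfl
  have : IsScalarTower A L Ω := .of_algebraMap_eq fun x ↦ (IsFractionRing.lift_algebraMap hψ x).symm
  -- The generic fiber is nonzero because it maps to `Ω`; the residue field at any maximal ideal is
  -- then finite over `L` by the Nullstellensatz.
  have : Nontrivial (L ⊗[A] D) :=
    (Algebra.TensorProduct.lift (Algebra.ofId L Ω) (IsScalarTower.toAlgHom A D Ω)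
      (fun _ _ ↦ Commute.all _ _)).toRingHom.domain_nontrivial
  obtain ⟨n, hn⟩ := Ideal.exists_maximal (L ⊗[A] D)
  let L' := (L ⊗[A] D) ⧸ n
  let : Field L' := Ideal.Quotient.field n
  have hfin : FiniteDimensional L L' := finite_of_finite_type_of_isJacobsonRing L L'
  let d : D →ₐ[A] L' := (Ideal.Quotient.mkₐ A n).comp Algebra.TensorProduct.includeRight
  refine ⟨⟨L', inferInstance, inferInstance, d.toRingHom, hfin, ?_⟩, ?_⟩
  · rw [← IsScalarTower.algebraMap_eq]
    exact d.comp_algebraMap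
  -- As a subring of `L'`, the image of `D` is a domain algebraic over `A`; a localization of it is
  -- étale.
  let T := d.range
  have : Algebra.FiniteType A T :=
    Algebra.FiniteType.of_surjective d.rangeRestrict d.rangeRestrict_surjective
  have : Algebra.IsAlgebraic A L' := IsFractionRing.comap_isAlgebraic_iff (K := L).mpr inferInstance
  have : Algebra.IsAlgebraic A T := ⟨fun x ↦
    (isAlgebraic_algHom_iff T.val Subtype.val_injective).mp (Algebra.IsAlgebraic.isAlgebraic x.1)⟩
  have hAL' : Function.Injective (algebraMap A L') := by
    rw [IsScalarTower.algebraMap_eq A L L']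
    exact (algebraMap L L').injective.comp (IsFractionRing.injective A L)
  have : FaithfulSMul A T := (faithfulSMul_iff_algebraMap_injective A T).mpr
    fun x y h ↦ hAL' congr(($h).1)
  obtain ⟨r, hr, het⟩ := exists_etale_localizationAway A T
  have : IsDomain (Localization.Away r) :=
    IsLocalization.isDomain_localization (powers_le_nonZeroDivisors_of_noZeroDivisors hr)
  refine ⟨Localization.Away r, inferInstance, inferInstance, inferInstance,
    (algebraMap T _).comp d.rangeRestrict.toRingHom, het, ?_⟩
  rw [IsScalarTower.algebraMap_eq A T (Localization.Away r), RingHom.comp_assoc]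
  congr 1
  exact d.rangeRestrict.comp_algebraMap

/-! ### Reducedness under flat unramified base change -/

open TensorProduct in
/-- Essentially finite type formally unramified algebras are geometrically reduced. -/
lemma geometricallyReduced_of_formallyUnramified (A B : Type u) [CommRing A] [CommRing B]
    [Algebra A B] [Algebra.FormallyUnramified A B] [Algebra.EssFiniteType A B] :
    GeometricallyReduced (Spec.map (CommRingCat.ofHom (algebraMap A B))) := by
  refine ⟨fun K _ y Y fst snd hY ↦ ?_⟩
  obtain ⟨φ, rfl⟩ := Spec.map_surjective y
  let := φ.hom.toAlgebra
  have : IsReduced (K ⊗[A] B) := Algebra.FormallyUnramified.isReduced_of_field K _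
  have h := isPullback_SpecMap_of_isPushout _ _ _ _ (CommRingCat.isPushout_tensorProduct A K B)
  exact isReduced_of_isOpenImmersion (hY.isoIsPullback _ _ h.flip).hom

/-- Reducedness is preserved by flat, formally unramified base change. -/
lemma isReduced_of_isPullback_of_formallyUnramified {A B : Type u} [CommRing A] [CommRing B]
    [Algebra A B] [Module.Flat A B] [Algebra.FormallyUnramified A B] [Algebra.EssFiniteType A B]
    {X Y : Scheme.{u}} {f : X ⟶ Spec (.of A)} {g : Y ⟶ Spec (.of B)} {y : Y ⟶ X}
    (h : IsPullback y g f (Spec.map (CommRingCat.ofHom (algebraMap A B)))) [IsReduced X]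
    [IsLocallyNoetherian X] : IsReduced Y := by
  have : GeometricallyReduced y :=
    MorphismProperty.of_isPullback h.flip (geometricallyReduced_of_formallyUnramified A B)
  have : Flat (Spec.map (CommRingCat.ofHom (algebraMap A B))) :=
    (HasRingHomProperty.Spec_iff (P := @Flat)).mpr ((RingHom.flat_algebraMap_iff).mpr ‹_›)
  have : Flat y := MorphismProperty.of_isPullback h.flip ‹_›
  exact GeometricallyReduced.isReduced_of_flat_of_isLocallyNoetherian y

/-! ### Spreading out the cylinder of one fiber -/

namespace Model

/-- A cylinder over an affine base that exists over a finite type extension of the base of a model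
induces cylinders after base change to any algebra with a compatible point. -/
theorem isA1Cylindrical_of_isPullback {A B : Type u} [CommRing A] [CommRing B] [Nontrivial B]
    [Algebra A B]
    [Module.Flat A B] [Algebra.FormallyUnramified A B] [Algebra.EssFiniteType A B]
    {X : Scheme.{u}} {f : X ⟶ Spec (.of A)} [IsReduced X] [IsLocallyNoetherian X]
    {R R' : CommRingCat.{u}} {a : R ⟶ .of A} (M : Model f a) {q : R ⟶ R'} {P : Scheme.{u}}
      {y : P ⟶ M.X}
    {g : P ⟶ Spec R'} (hP : IsPullback y g M.x (Spec.map q)) {Z : Scheme.{u}} {z : Z ⟶ Spec R'}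
    [LocallyOfFiniteType z] [QuasiCompact z] (φ : 𝔸(PUnit.{u + 1}; Z) ⟶ P) [IsOpenImmersion φ]
    (w : φ ≫ g = (𝔸(PUnit.{u + 1}; Z) ↘ Z) ≫ z) (t : Spec (.of B) ⟶ Z)
    (ht : t ≫ z ≫ Spec.map q = Spec.map (CommRingCat.ofHom (algebraMap A B)) ≫ Spec.map a)
    {Y : Scheme.{u}} {h : Y ⟶ Spec (.of B)} {y' : Y ⟶ X}
    (hY : IsPullback y' h f (Spec.map (CommRingCat.ofHom (algebraMap A B)))) :
    IsA1Cylindrical h := by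
  have h1 : IsPullback (y' ≫ M.i) h M.x ((t ≫ z) ≫ Spec.map q) := by
    rw [Category.assoc, ht]
    exact (hY.flip.paste_vert M.isPullback.flip).flip
  have h2 : IsPullback (hP.lift (y' ≫ M.i) (h ≫ t ≫ z) (by
      rw [h1.w]; simp only [Category.assoc])) h g (t ≫ z) :=
    IsPullback.of_right (by rw [hP.lift_fst]; exact h1) (hP.lift_snd _ _ _) hP
  obtain ⟨φ', hφ, w'⟩ := exists_affineSpace_baseChange h2 (IsPullback.of_hasPullback z (t ≫ z)) φ w
  -- The base of the new cylinder is reduced because its affine line is open in the reduced scheme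
  -- `Y`.
  have : IsReduced Y := isReduced_of_isPullback_of_formallyUnramified hY
  have := isReduced_of_isOpenImmersion φ'
  -- The point `t` of `Z` gives a section of the base-changed `Z`, so the new base is nonempty.
  let pt : Spec (.of B) ⟶ pullback z (t ≫ z) := pullback.lift t (𝟙 _) (by simp)
  exact ⟨⟨_, pullback.snd z (t ≫ z), φ', ⟨pt (Nonempty.some inferInstance)⟩,
    ⟨isReduced_of_affineSpace _ (n := PUnit.{u + 1}), inferInstance, inferInstance⟩, hφ, w'⟩⟩

/-- A cylinder over a field descends to a finite type extension of the base of a model, and induces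
cylinders after base change to any algebra with a compatible point. -/
theorem exists_ring_of_isA1Cylindrical {A : Type u} [CommRing A] {X : Scheme.{u}}
    {f : X ⟶ Spec (.of A)} [IsReduced X]
    [IsLocallyNoetherian X] {R : CommRingCat.{u}} [IsNoetherianRing R] {a : R ⟶ .of A}
      (M : Model f a)
    {K : CommRingCat.{u}} [IsSimpleRing K] [IsNoetherianRing K] {s : .of A ⟶ K}
    (hs : Function.Injective (a ≫ s).hom) {Y : Scheme.{u}} {y : Y ⟶ X} {g : Y ⟶ Spec K}
    (hY : IsPullback y g f (Spec.map s)) (hg : IsA1Cylindrical g) :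
    ∃ (C : CommRingCat.{u}) (c : R ⟶ C) (Ω : Type u) (_ : Field Ω) (ω : C →+* Ω),
      c.hom.FiniteType ∧ Function.Injective (ω.comp c.hom) ∧
      ∀ (B : Type u) [CommRing B] [Nontrivial B] [Algebra A B]
        [Module.Flat A B] [Algebra.FormallyUnramified A B] [Algebra.EssFiniteType A B]
        (b : C →+* B), b.comp c.hom = (algebraMap A B).comp a.hom →
        ∀ {Y' : Scheme.{u}} {h : Y' ⟶ Spec (.of B)} {y' : Y' ⟶ X}
          (_ : IsPullback y' h f (Spec.map (CommRingCat.ofHom (algebraMap A B)))),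
          IsA1Cylindrical h := by
  obtain ⟨c⟩ := hg
  have := c.isOpenImmersion
  have := c.isVarietyOver.locallyOfFiniteType
  obtain ⟨z⟩ := c.nonempty
  -- Shrinking the base of the cylinder to an affine neighborhood of a point makes its model affine,
  -- hence determined by a ring.
  obtain ⟨W, hW, hzW⟩ : ∃ W : c.Z.Opens, IsAffineOpen W ∧ z ∈ W := by
    obtain ⟨_, ⟨W, hW, rfl⟩, hzW, -⟩ :=
      c.Z.isBasis_affineOpens.exists_subset_of_mem_open (Set.mem_univ z) isOpen_univ
    exact ⟨W, hW, hzW⟩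
  have : IsAffine W := hW
  have : IsOpenImmersion (AffineSpace.map PUnit.{u + 1} W.ι) :=
    MorphismProperty.of_isPullback (AffineSpace.isPullback_map W.ι).flip
      (inferInstance : IsOpenImmersion W.ι)
  obtain ⟨r, N, P, y, gP, φ, hN, hP, hφ, w⟩ := (M.ofIsPullback hY).exists_cylinder (W.ι ≫ c.p)
    (AffineSpace.map PUnit.{u + 1} W.ι ≫ c.φ) (by
      rw [Category.assoc, c.w, AffineSpace.map_over_assoc])
  let x : W.toScheme := ⟨z, hzW⟩
  -- Taking the coordinate ring of the descended base itself, instead of `r.ring`, makes a point of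
  -- `C` do two things: it extends the map from `r.ring` and exhibits a point of the new base.
  let C := Γ(N.X, ⊤)
  obtain ⟨d, hd⟩ : ∃ d : r.ring ⟶ C, N.X.isoSpec.hom ≫ Spec.map d = N.x :=
    ⟨Spec.preimage (N.X.isoSpec.inv ≫ N.x), by simp⟩
  let p : Spec (W.toScheme.residueField x) ⟶ Spec C :=
    W.toScheme.fromSpecResidueField x ≫ N.i ≫ N.X.isoSpec.hom
  obtain ⟨ω, hω⟩ := Spec.map_surjective p
  obtain ⟨κ, hκ⟩ := Spec.map_surjective (W.toScheme.fromSpecResidueField x ≫ W.ι ≫ c.p)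
  -- The two routes from `R` to the residue field at `x`, through `C` and through `K`, agree; the
  -- second is injective by `hs`.
  have hcomm : (r.q ≫ d) ≫ ω = (a ≫ s) ≫ κ := by
    apply Spec.map_injective
    have h1 : Spec.map r.p ≫ Spec.map r.q = Spec.map (a ≫ s) := by rw [← Spec.map_comp, r.fac]
    have h2 : N.i ≫ N.x ≫ Spec.map r.q = (W.ι ≫ c.p) ≫ Spec.map (a ≫ s) := by
      rw [N.isPullback.w_assoc, h1]
    rw [Spec.map_comp, Spec.map_comp, hω, Spec.map_comp (a ≫ s), hκ]
    simp only [p, Category.assoc] at h2 ⊢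
    rw [reassoc_of% hd, h2]
  refine ⟨C, r.q ≫ d, W.toScheme.residueField x, inferInstance, ω.hom, ?_, ?_, ?_⟩
  · have : LocallyOfFiniteType (Spec.map d) := by
      rw [← Iso.eq_inv_comp] at hd
      rw [hd]
      infer_instance
    exact ((HasRingHomProperty.Spec_iff (P := @LocallyOfFiniteType)).mp this).comp r.finiteType
  · have : ω.hom.comp (r.q ≫ d).hom = κ.hom.comp (a ≫ s).hom := congr(($hcomm).hom)
    rw [this]
    exact κ.hom.injective.comp hs
  · intro B _ _ _ _ _ _ b hb Y' h y' hY'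
    refine M.isA1Cylindrical_of_isPullback hP φ w (Spec.map (CommRingCat.ofHom b) ≫ N.X.isoSpec.inv)
      ?_ hY'
    rw [← hd, ← Spec.map_comp]
    simp only [Category.assoc, Iso.inv_hom_id_assoc, ← Spec.map_comp]
    congr 1
    ext x
    exact congr($hb x)

end Model

/-! ### Countable models; residue fields on affine opens -/

/-- Finite type algebras over countable rings are countable. -/
lemma Algebra.FiniteType.countable {R A : Type u} [CommRing R] [CommRing A] [Algebra R A]
    [Countable R]
    [Algebra.FiniteType R A] : Countable A := by
  obtain ⟨n, g, hg⟩ := Algebra.FiniteType.iff_quotient_mvPolynomial''.mp ‹Algebra.FiniteType R A›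
  have : Countable (MvPolynomial (Fin n) R) := by
    rw [← Cardinal.mk_le_aleph0_iff]
    refine MvPolynomial.cardinalMk_le_max_lift.trans ?_
    simp
  exact hg.countable

lemma AlgebraicGeometry.Scheme.SpecMap_evaluation_fromSpec {S : Scheme.{u}} {V : S.Opens}
    (hV : IsAffineOpen V) (s : S) (hs : s ∈ V) :
    Spec.map (S.evaluation V s hs) ≫ hV.fromSpec = S.fromSpecResidueField s := by
  rw [← Scheme.germ_residue, Spec.map_comp, Category.assoc, Scheme.fromSpecResidueField,
    ← IsAffineOpen.fromSpecStalk_eq_fromSpecStalk hV hs]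
  rfl

/-- The residue field at the generic point is the fraction field of sections over affine opens. -/
lemma AlgebraicGeometry.IsAffineOpen.isFractionRing_residueField {S : Scheme.{u}} [IsIntegral S]
    {V : S.Opens} (hV : IsAffineOpen V) (hs : genericPoint S ∈ V) :
    letI := (S.evaluation V (genericPoint S) hs).hom.toAlgebra
    IsFractionRing Γ(S, V) (S.residueField (genericPoint S)) := by
  have : Nonempty V := ⟨⟨_, hs⟩⟩
  have := functionField_isFractionRing_of_isAffineOpen S V hV
  let := (S.evaluation V (genericPoint S) hs).hom.toAlgebra
  have hb : Function.Bijective (S.residue (genericPoint S)).hom :=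
    ⟨RingHom.injective (R := S.functionField) _, S.residue_surjective _⟩
  let e : S.functionField ≃ₐ[Γ(S, V)] S.residueField (genericPoint S) :=
    AlgEquiv.ofRingEquiv (f := RingEquiv.ofBijective _ hb) fun x ↦ rfl
  exact IsLocalization.isLocalization_of_algEquiv _ e

/-- In a Jacobson space, a point closed in an open subspace is closed in the whole space. -/
lemma isClosed_singleton_fromSpec {S : Scheme.{u}} [JacobsonSpace S] {V : S.Opens} (hV
    : IsAffineOpen V)
    {x : Spec Γ(S, V)} (hx : IsClosed {x}) : IsClosed {hV.fromSpec x} := by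
  have h := hV.fromSpec.isOpenEmbedding.preimage_closedPoints
  have : x ∈ closedPoints (Spec Γ(S, V)) := hx
  rwa [← h] at this

/-- The evaluation induces the inclusion of the point, so the zero ideal of the residue field pulls
back to the prime of `x`. -/
lemma ker_evaluation {S : Scheme.{u}} {V : S.Opens} (hV : IsAffineOpen V) (x : Spec Γ(S, V))
    (hx : hV.fromSpec x ∈ V) :
    RingHom.ker (S.evaluation V (hV.fromSpec x) hx).hom = x.asIdeal := by
  have h := Scheme.SpecMap_evaluation_fromSpec hV _ hx
  let p : Spec (S.residueField (hV.fromSpec x)) := (⊥ : PrimeSpectrum _)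
  have h1 : hV.fromSpec (Spec.map (S.evaluation V _ hx) p) = hV.fromSpec x := by
    rw [← Scheme.Hom.comp_apply, h, Scheme.fromSpecResidueField_apply]
  exact congrArg PrimeSpectrum.asIdeal (hV.fromSpec.isOpenEmbedding.injective h1)

/-- Every scheme of finite type over a noetherian domain has a model over a countable noetherian
subring. -/
theorem exists_countable_model {A : Type u} [CommRing A] [IsNoetherianRing A] {X : Scheme.{u}}
    (f : X ⟶ Spec (.of A)) [LocallyOfFiniteType f] [QuasiCompact f] :
    ∃ (R : CommRingCat.{u}) (a : R ⟶ .of A), Countable R ∧ IsNoetherianRing R ∧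
      Function.Injective a.hom ∧ Nonempty (Model f a) := by
  let a₀ : CommRingCat.of (ULift.{u} ℤ) ⟶ .of A :=
    CommRingCat.ofHom ((algebraMap ℤ A).comp ULift.ringEquiv.toRingHom)
  have : IsNoetherianRing (CommRingCat.of (ULift.{u} ℤ)) :=
    isNoetherianRing_of_ringEquiv ℤ ULift.ringEquiv.symm
  have : Countable (CommRingCat.of (ULift.{u} ℤ)) := ULift.down_injective.countable
  obtain ⟨s, ⟨M⟩⟩ := Model.exists_of_finiteType a₀ f
  have : Countable s.ring := by
    let := s.q.hom.toAlgebra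
    have : Algebra.FiniteType (CommRingCat.of (ULift.{u} ℤ)) s.ring := s.finiteType
    exact Algebra.FiniteType.countable (R := CommRingCat.of (ULift.{u} ℤ))
  have := s.isNoetherianRing
  -- `s.p` need not be injective, so `s.ring` is replaced by its image in `A`, which stays countable
  -- and noetherian.
  have hr := s.p.hom.rangeRestrict_surjective
  exact ⟨.of s.p.hom.range, CommRingCat.ofHom s.p.hom.range.subtype, hr.countable,
    isNoetherianRing_of_surjective _ _ _ hr, Subtype.val_injective,
    ⟨M.baseChange (CommRingCat.ofHom s.p.hom.rangeRestrict) _ rfl⟩⟩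

/-! ### The theorem over an affine base -/

open TensorProduct in
/-- If the closed fibers of a family over an affine base contain cylinders, then so do its base
changes to a finite extension of the function field and to a generically étale extension. -/
theorem exists_isA1Cylindrical_of_closedFibers (k : Type u) [Field k] [Uncountable k] {A : Type u}
    [CommRing A]
    [IsDomain A] [CharZero A] [Algebra k A] [Algebra.FiniteType k A] (L : Type u) [Field L]
    [Algebra A L] [IsFractionRing A L] {X : Scheme.{u}} (f : X ⟶ Spec (.of A))
    [LocallyOfFiniteType f] [QuasiCompact f] [IsReduced X]
    (hf : ∀ m : Ideal A, m.IsMaximal → ∃ (K : CommRingCat.{u}) (s : .of A ⟶ K) (Y : Scheme.{u})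
      (y : Y ⟶ X) (g : Y ⟶ Spec K), IsSimpleRing K ∧ IsNoetherianRing K ∧ RingHom.ker s.hom = m ∧
        IsPullback y g f (Spec.map s) ∧ IsA1Cylindrical g) :
    (∃ (L' : Type u) (_ : Field L') (_ : Algebra L L'), FiniteDimensional L L' ∧
      ∀ {Y : Scheme.{u}} {y : Y ⟶ X} {h : Y ⟶ Spec (.of L')}
        (_ : IsPullback y h f (Spec.map (CommRingCat.ofHom ((algebraMap L L').comp
          (algebraMap A L))))),
        IsA1Cylindrical h) ∧
    ∃ (T : Type u) (_ : CommRing T) (_ : IsDomain T) (_ : Algebra A T), Algebra.Etale A T ∧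
      ∀ {Y : Scheme.{u}} {y : Y ⟶ X} {h : Y ⟶ Spec (.of T)}
        (_ : IsPullback y h f (Spec.map (CommRingCat.ofHom (algebraMap A T)))),
        IsA1Cylindrical h := by
  have : IsNoetherianRing A := Algebra.FiniteType.isNoetherianRing k A
  have : IsLocallyNoetherian X := LocallyOfFiniteType.isLocallyNoetherian f
  obtain ⟨R, a, hR, hR', ha, ⟨M⟩⟩ := exists_countable_model f
  obtain ⟨m, hm, hma⟩ := exists_isMaximal_comap_eq_bot k a.hom ha
  obtain ⟨K, s, Y, y, g, hK, hK', hs, hY, hg⟩ := hf m hm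
  -- Since `m` meets `R` only in zero, `R` embeds into `K`: for the model, this closed fiber lies
  -- over the generic point of `Spec R`.
  have hinj : Function.Injective (a ≫ s).hom := by
    rw [RingHom.injective_iff_ker_eq_bot, ← hma, ← hs]
    rfl
  obtain ⟨C, c, Ω, _, ω, hc, hω, H⟩ := M.exists_ring_of_isA1Cylindrical hinj hY hg
  let := a.hom.toAlgebra
  let := c.hom.toAlgebra
  have : Algebra.FiniteType R C := hc
  -- A common overfield of `L` and `Ω` over `R` gives `A ⊗[R] C` a point over the generic point of
  -- `Spec A`.
  obtain ⟨Ω', _, i, j, hij⟩ := exists_field_comp_eq ((algebraMap A L).comp a.hom) (ω.comp c.hom)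
    ((IsFractionRing.injective A L).comp ha) hω
  let := (i.comp ((algebraMap A L).comp a.hom)).toAlgebra
  let ψ : A ⊗[R] C →ₐ[R] Ω' := Algebra.TensorProduct.lift (S := R)
    { i.comp (algebraMap A L) with commutes' _ := rfl }
    { j.comp ω with commutes' x := congr($hij x).symm } (fun _ _ ↦ Commute.all _ _)
  have hψ : Function.Injective (ψ.toRingHom.comp (algebraMap A (A ⊗[R] C))) := by
    have : ψ.toRingHom.comp (algebraMap A (A ⊗[R] C)) = i.comp (algebraMap A L) := by
      ext x
      change ψ (x ⊗ₜ 1) = _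
      rw [Algebra.TensorProduct.lift_tmul, map_one, mul_one]
      rfl
    rw [this]
    exact i.injective.comp (IsFractionRing.injective A L)
  have hD {B : Type u} [CommRing B] (d : A ⊗[R] C →+* B) :
      (d.comp Algebra.TensorProduct.includeRight.toRingHom).comp c.hom =
        (d.comp (algebraMap A (A ⊗[R] C))).comp a.hom := by
    ext x
    exact congr_arg d (Algebra.TensorProduct.includeRight.commutes x)
  obtain ⟨⟨L', _, _, d, hL', hd⟩, T, _, _, _, d', hT, hd'⟩ :=
    exists_finite_and_exists_etale L ψ.toRingHom hψ
  refine ⟨⟨L', inferInstance, inferInstance, hL', fun hY ↦ ?_⟩,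
    ⟨T, inferInstance, inferInstance, inferInstance, hT, fun hY ↦ ?_⟩⟩
  · let := ((algebraMap L L').comp (algebraMap A L)).toAlgebra
    have : IsScalarTower A L L' := .of_algebraMap_eq' rfl
    have : CharZero L := charZero_of_injective_algebraMap (IsFractionRing.injective A L)
    have : Module.Flat A L := IsLocalization.flat L (nonZeroDivisors A)
    have : Module.Flat A L' := Module.Flat.trans A L L'
    have : Algebra.FormallyUnramified A L :=
      Algebra.FormallyUnramified.of_isLocalization (nonZeroDivisors A)
    have : Algebra.FormallyUnramified L L' := Algebra.FormallyUnramified.of_isSeparable L L'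
    have : Algebra.FormallyUnramified A L' := Algebra.FormallyUnramified.comp A L L'
    have : Algebra.EssFiniteType A L := Algebra.EssFiniteType.of_isLocalization L
      (nonZeroDivisors A)
    have : Algebra.EssFiniteType A L' := Algebra.EssFiniteType.comp A L L'
    exact H L' _ ((hD d).trans congr(($hd).comp a.hom)) hY
  · exact H T _ ((hD d').trans congr(($hd').comp a.hom)) hY

/-! ### Reduction to an affine base -/

theorem theorem1 (k : Type u) [Field k] [CharZero k] [Uncountable k]
    (X S : Scheme.{u}) (πX : X ⟶ Spec (CommRingCat.of k)) (πS : S ⟶ Spec (CommRingCat.of k))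
    (hX : IsVarietyOver πX) (hS : IsVarietyOver πS)
    [GeometricallyIntegral πX] [GeometricallyIntegral πS]
    (f : X ⟶ S) (hf : f ≫ πS = πX) [IsDominant f]
    (hcyl : ∃ U : S.Opens, Dense (U : Set S) ∧
      ∀ s : S, s ∈ U → IsClosed ({s} : Set S) → IsA1Cylindrical (f.fiberToSpecResidueField s)) :
    (∃ (T : Scheme.{u}) (g : T ⟶ S), Etale g ∧ IsVarietyOver (g ≫ πS) ∧
      IsA1Cylindrical (pullback.snd f g)) ∧
    (∃ η : S, IsGenericPoint η (Set.univ : Set S) ∧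
      ∃ (L : Type u) (_ : Field L) (_ : Algebra (S.residueField η) L),
        FiniteDimensional (S.residueField η) L ∧
        IsA1Cylindrical (pullback.snd (f.fiberToSpecResidueField η)
          (Spec.map (CommRingCat.ofHom (algebraMap (S.residueField η) L))))) := by
  have := hX.isReduced
  have := hX.locallyOfFiniteType
  have := hX.quasiCompact
  have := hS.locallyOfFiniteType
  have : IsIntegral S := GeometricallyIntegral.isIntegral_of_subsingleton πS
  have : JacobsonSpace S := LocallyOfFiniteType.jacobsonSpace πS
  have : IsLocallyNoetherian S := LocallyOfFiniteType.isLocallyNoetherian πS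
  have : LocallyOfFiniteType (f ≫ πS) := hf ▸ ‹_›
  have : QuasiCompact (f ≫ πS) := hf ▸ ‹_›
  have : LocallyOfFiniteType f := locallyOfFiniteType_of_comp f πS
  have : QuasiCompact f := .of_comp f πS
  obtain ⟨U, hU, hcyl⟩ := hcyl
  obtain ⟨x, hx⟩ := hU.nonempty
  -- An affine open inside `U` suffices: its closed points are closed in `S`, its generic point is
  -- that of `S`, and an étale scheme over it is étale over `S`.
  obtain ⟨_, ⟨V, hV, rfl⟩, hxV, hVU⟩ : ∃ V ∈ _, x ∈ V ∧ V ⊆ (U : Set S) :=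
    S.isBasis_affineOpens.exists_subset_of_mem_open hx U.isOpen
  have hV : IsAffineOpen V := hV
  have : Nonempty V := ⟨⟨x, hxV⟩⟩
  let A := Γ(S, V)
  let ι : Spec A ⟶ S := hV.fromSpec
  obtain ⟨κ, hκ⟩ := Spec.map_surjective (ι ≫ πS)
  have hκ' : κ.hom.FiniteType := by
    have : LocallyOfFiniteType (Spec.map κ) := hκ ▸ inferInstance
    exact (HasRingHomProperty.Spec_iff (P := @LocallyOfFiniteType)).mp this
  let := κ.hom.toAlgebra
  have : Algebra.FiniteType k A := hκ'
  have : CharZero A := charZero_of_injective_algebraMap (algebraMap k A).injective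
  let η := genericPoint S
  have hη : η ∈ V :=
    ((genericPoint_spec S).mem_open_set_iff V.isOpen).mpr (by simpa using ⟨x, hxV⟩)
  let := (S.evaluation V η hη).hom.toAlgebra
  have : IsFractionRing A (S.residueField η) := hV.isFractionRing_residueField hη
  let f' : pullback f ι ⟶ Spec (.of A) := pullback.snd f ι
  have : LocallyOfFiniteType f' :=
    MorphismProperty.of_isPullback (IsPullback.of_hasPullback f ι) ‹_›
  have : QuasiCompact f' :=
    MorphismProperty.of_isPullback (IsPullback.of_hasPullback f ι) ‹_›
  have : IsReduced (pullback f ι) := isReduced_of_isOpenImmersion (pullback.fst f ι)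
  -- Fibers of `f` over points of `V` are base changes of `f'` along evaluation; this serves both
  -- the closed points and the generic point.
  have hfib (s : S) (hs : s ∈ V) : ∃ y, IsPullback y (f.fiberToSpecResidueField s) f'
      (Spec.map (S.evaluation V s hs)) := by
    have h : IsPullback (f.fiberι s) (f.fiberToSpecResidueField s) f
        (Spec.map (S.evaluation V s hs) ≫ ι) := by
      rw [Scheme.SpecMap_evaluation_fromSpec hV]
      exact IsPullback.of_hasPullback _ _
    exact ⟨_, IsPullback.of_right (by rwa [pullback.lift_fst])
      (pullback.lift_snd (f.fiberι s) _ (h.w.trans (Category.assoc _ _ _).symm))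
      (IsPullback.of_hasPullback f ι)⟩
  obtain ⟨⟨L', _, _, hL', H⟩, T, _, _, _, hT, H'⟩ :=
    exists_isA1Cylindrical_of_closedFibers k (S.residueField η) f' fun m hm ↦ by
      let p : PrimeSpectrum A := ⟨m, hm.isPrime⟩
      have hp : IsClosed {p} := (PrimeSpectrum.isClosed_singleton_iff_isMaximal p).mpr hm
      have hpV : hV.fromSpec p ∈ V := by
        rw [← SetLike.mem_coe, ← hV.range_fromSpec]
        exact ⟨p, rfl⟩
      obtain ⟨y, hy⟩ := hfib _ hpV
      exact ⟨_, _, _, y, _, inferInstance, inferInstance, ker_evaluation hV p hpV, hy,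
        hcyl _ (hVU hpV) (isClosed_singleton_fromSpec hV hp)⟩
  have : Etale (Spec.map (CommRingCat.ofHom (algebraMap A T))) :=
    (HasRingHomProperty.Spec_iff (P := @Etale)).mpr (RingHom.etale_algebraMap.mpr hT)
  refine ⟨⟨Spec (.of T), Spec.map (CommRingCat.ofHom (algebraMap A T)) ≫ ι, ?_, ?_, ?_⟩,
    η, genericPoint_spec S, L', inferInstance, inferInstance, hL', ?_⟩
  · infer_instance
  · exact ⟨inferInstance, inferInstance, inferInstance⟩
  · exact H' (IsPullback.of_right (by rw [pullback.lift_fst]; exact IsPullback.of_hasPullback _ _)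
      (pullback.lift_snd (pullback.fst f _) _ (pullback.condition.trans
        (Category.assoc _ _ _).symm))
      (IsPullback.of_hasPullback f ι))
  · obtain ⟨y, hy⟩ := hfib η hη
    have h := ((IsPullback.of_hasPullback (f.fiberToSpecResidueField η) (Spec.map
      (CommRingCat.ofHom (algebraMap (S.residueField η) L')))).flip.paste_vert hy.flip).flip
    refine H (Eq.subst (motive := IsPullback _ _ f') ?_ h)
    exact (Spec.map_comp (S.evaluation V η hη)
      (CommRingCat.ofHom (algebraMap (S.residueField η) L'))).symm
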